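/- Let $F$ be a field of characteristic different from $2$ and $3$, and let $\mathfrak g$ be the Lie algebra of a split simple linear algebraic group of type $D_4$ over $F$, with Chevalley basis $h_1,\dots,h_4$, $x_\beta$ ($\beta$ a root). Let $\alpha_1,\alpha_2,\alpha_3,\alpha_4$ be the simple roots, $\alpha=\alpha_2$ being the central node of the Dynkin diagram, and let $\rho=\alpha_1+2\alpha_2+\alpha_3+\alpha_4$ be the highest root. Let $\mathfrak g_1\subset\mathfrak g$ be the span of the root vectors $x_\beta$ for which $\alpha$ has coefficient $1$ in $\beta$, and let $q$ be the quartic form on $\mathfrak g_1$ defined by $(\operatorname{ad}y)^4(x_{-\rho})=q(y)\,x_\rho$. (1) $\dim_F\mathfrak g_1=8$, and there is an $F$-linear isomorphism from $\mathfrak g_1$ to Bhargava's space $F^2\otimes F^2\otimes F^2$ of $2\times2\times2$ cubes that carries $q$ to $6\operatorname{Disc}$, where $\operatorname{Disc}$ is the quartic discriminant of a cube (Cayley's hyperdeterminant). (2) The stabilizer of $q$ in $\operatorname{GL}(\mathfrak g_1)$, as an algebraic group, is $\langle \operatorname{SL}_2^3,\mu_4\rangle\rtimes S_3$. Here $\operatorname{SL}_2^3$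 stands for its image under the action $\varphi$ on $\mathfrak g_1$ that integrates the adjoint action of the subalgebra $\mathfrak{sl}_2^3$ generated by $x_{\pm\alpha_1},x_{\pm\alpha_3},x_{\pm\alpha_4}$ (the elementary matrices in the three factors act as $\exp(t\operatorname{ad}x_{\pm\alpha_i})$); $\mu_4$ is the group of fourth roots of unity, acting by scalars; and $S_3$ acts on $\mathfrak g_1$ through the diagram automorphisms of $\mathfrak g$, that is, the automorphisms that fix $x_{\pm\alpha_2}$ and permute the $x_{\alpha_i}$, and likewise the $x_{-\alpha_i}$, for $i=1,3,4$. Explicitly, let $K$ be any separably closed extension field of $F$, and let $\mathfrak g_{1,K}=K\otimes_F\mathfrak g_1$, with the quartic form defined in the same way over $K$. Then the actions $\varphi$ of $\operatorname{SL}_2(K)^3$ and $\delta$ of $S_3$ on $\mathfrak g_{1,K}$ exist, and, with $N=\langle\varphi(\operatorname{SL}_2(K)^3),\mu_4(K)\rangle$, the map $(n,\sigma)\mapsto n\,\delta(\sigma)$ is an isomorphism of a semidirect product $N\rtimes S_3$ onto the stabilizer of the quartic form in $\operatorname{GL}(\mathfrak g_{1,K})$. Moreover, an element of $\operatorname{GL}(\mathfrak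 g_1)$ stabilizes $q$ if and only if its $K$-linear extension to $\mathfrak g_{1,K}$ lies in $N\,\delta(S_3)$. -/

import Mathlib

open scoped TensorProduct Matrix

noncomputable section

namespace D4

/-! ### The root system of type `D₄`

Elements of the root lattice are written in coordinates with respect to the simple roots
`α₁, α₂, α₃, α₄`, which have the indices `0, 1, 2, 3`; the node `α₂` (index `1`) is the centre
of the Dynkin diagram. -/

/-- The pairing `⟨β, γ⟩`. The root system is simply laced and all roots are normalised to have
`⟨β, β⟩ = 2`, so this is a symmetric bilinear form, with the Cartan matrix as Gram matrix. -/
def pairing (β γ : Fin 4 → ℤ) : ℤ := β ⬝ᵥ (CartanMatrix.D 4 *ᵥ γ)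

/-- The roots of `D₄`: the vectors of square length `2` in the root lattice. -/
def Root : Type := {β : Fin 4 → ℤ // pairing β β = 2}

instance : Neg Root :=
  ⟨fun β => ⟨-β.1, by
    have h := β.2
    simpa [pairing, Matrix.mulVec_neg] using h⟩⟩

/-- The simple roots. -/
def simple (i : Fin 4) : Root :=
  ⟨Pi.single i 1, by fin_cases i <;> decide⟩

/-- The highest root `ρ = α₁ + 2α₂ + α₃ + α₄`. -/
def rho : Root := ⟨![1, 2, 1, 1], by decide⟩

/-- The `α`-height of a root, for `α = α₂`: the coefficient of `α₂`. -/
def Root.height (β : Root) : ℤ := β.1 1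

theorem Root.height_eq_pairing_rho (β : Root) : β.height = pairing β.1 rho.1 := by
  have h : CartanMatrix.D 4 *ᵥ rho.1 = ![0, 1, 0, 0] := by decide
  simp [Root.height, pairing, h, dotProduct, Fin.sum_univ_four]

/-- The three outer nodes `α₁, α₃, α₄` of the Dynkin diagram. -/
def leg : Fin 3 → Fin 4 := ![0, 2, 3]

/-! ### Chevalley bases -/

/-- A Chevalley basis of type `D₄` of a Lie algebra `L` over `F`: a basis that consists of
elements `hᵢ` for the simple roots and root vectors `x_β`, with
`[hᵢ, hⱼ] = 0`, `[hᵢ, x_β] = ⟨β, αᵢ⟩ x_β`, `[x_β, x_{-β}] = h_β = ∑ βᵢ hᵢ`,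
`[x_β, x_γ] = c_{β,γ} x_{β+γ}` if `β + γ` is a root, where `c_{β,γ} = ±1` is an integer with
`c_{-β,-γ} = -c_{β,γ}`, and `[x_β, x_γ] = 0` if `β + γ` is neither a root nor `0`.
A Lie algebra with such a basis is the split simple Lie algebra of type `D₄` over `F`. -/
structure ChevalleyBasis (F L : Type*) [Field F] [LieRing L] [LieAlgebra F L] where
  basis : Module.Basis (Fin 4 ⊕ Root) F L
  lie_h_h : ∀ i j : Fin 4, ⁅basis (.inl i), basis (.inl j)⁆ = 0
  lie_h_x : ∀ (i : Fin 4) (β : Root),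
    ⁅basis (.inl i), basis (.inr β)⁆ = pairing β.1 (simple i).1 • basis (.inr β)
  lie_x_neg : ∀ β : Root, ⁅basis (.inr β), basis (.inr (-β))⁆ = ∑ i, β.1 i • basis (.inl i)
  lie_x_x : ∀ β γ δ : Root, β.1 + γ.1 = δ.1 → ∃ c : ℤ, (c = 1 ∨ c = -1) ∧
    ⁅basis (.inr β), basis (.inr γ)⁆ = c • basis (.inr δ) ∧
    ⁅basis (.inr (-β)), basis (.inr (-γ))⁆ = (-c) • basis (.inr (-δ))
  lie_x_x_eq_zero : ∀ β γ : Root, β.1 + γ.1 ≠ 0 → (¬ ∃ δ : Root, β.1 + γ.1 = δ.1) →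
    ⁅basis (.inr β), basis (.inr γ)⁆ = 0

namespace ChevalleyBasis

section

variable {F L : Type*} [Field F] [LieRing L] [LieAlgebra F L] (C : ChevalleyBasis F L)

/-- The root vector `x_β`. -/
def x (β : Root) : L := C.basis (.inr β)

/-- The grade `1` part `𝔤₁`: the sum of the root spaces of the roots of `α`-height `1`. -/
def g1 : Submodule F L := Submodule.span F {y | ∃ β : Root, β.height = 1 ∧ y = C.x β}

/-- The quartic form on `𝔤₁`, defined by `(ad y)⁴ x_{-ρ} = q(y) x_ρ`. Since `(ad y)⁴ x_{-ρ}` lies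
in `𝔤₂ = F x_ρ`, it is given by its coordinate at `x_ρ`. -/
def q (y : C.g1) : F :=
  C.basis.repr ⁅(y : L), ⁅(y : L), ⁅(y : L), ⁅(y : L), C.x (-rho)⁆⁆⁆⁆ (.inr rho)

/-- The stabilizer of the quartic form in `GL(𝔤₁)`. -/
def stab : Subgroup (C.g1 ≃ₗ[F] C.g1) where
  carrier := {g | ∀ y, C.q (g y) = C.q y}
  one_mem' := fun _ => rfl
  mul_mem' := fun {a b} ha hb y => (ha (b y)).trans (hb y)
  inv_mem' := fun {a} ha y => by
    have h := ha (a⁻¹ y)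
    rw [← h]
    congr 1
    exact a.apply_symm_apply y

/-- The group `μ₄` of fourth roots of unity, as scalars in `GL(𝔤₁)`. -/
def mu4 : Subgroup (C.g1 ≃ₗ[F] C.g1) :=
  (rootsOfUnity 4 F).map (DistribMulAction.toModuleAut F C.g1)

/-- The automorphism `exp (t ad x_β)` of `L`; here `(ad x_β)³ = 0`. -/
def rootExp (β : Root) (t : F) : L →ₗ[F] L :=
  LinearMap.id + t • (LieAlgebra.ad F L (C.x β) : L →ₗ[F] L)
    + (t ^ 2 / 2) • ((LieAlgebra.ad F L (C.x β) : L →ₗ[F] L) ∘ₗ (LieAlgebra.ad F L (C.x β)))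

/-- `φ` is the action of `SL₂(F)³` on `𝔤₁` that integrates the adjoint action of
`𝔰𝔩₂³ ⊆ 𝔤₀`, the subalgebra generated by the `x_{±αᵢ}` for the three outer nodes: in the factor
that belongs to `αᵢ`, the elementary matrices with upper (lower) entry `t` act as
`exp (t ad x_{αᵢ})` (as `exp (t ad x_{-αᵢ})`). Elementary matrices generate `SL₂(F)`, so
these conditions determine `φ`. -/
def IsSL2CubeAction
    (φ : (Fin 3 → Matrix.SpecialLinearGroup (Fin 2) F) →* (C.g1 ≃ₗ[F] C.g1)) : Prop :=
  ∀ (i : Fin 3) (t : F) (y : C.g1),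
    ((φ (Pi.mulSingle i ⟨!![1, t; 0, 1], by simp⟩) y : C.g1) : L)
      = C.rootExp (simple (leg i)) t y ∧
    ((φ (Pi.mulSingle i ⟨!![1, 0; t, 1], by simp⟩) y : C.g1) : L)
      = C.rootExp (-simple (leg i)) t y

/-- `δ` is the action of `S₃` on `𝔤₁` by the diagram automorphisms of `𝔤`: it is the restriction
of the automorphisms `Δ σ` of the Lie algebra `𝔤` that fix `x_{±α₂}` and permute the `x_{±αᵢ}` for
the outer nodes `αᵢ`. The `x_{±αᵢ}` generate `𝔤`, so this determines `Δ` and `δ`, and `Δ` is an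
action. -/
def IsDiagramAction (δ : Equiv.Perm (Fin 3) →* (C.g1 ≃ₗ[F] C.g1)) : Prop :=
  ∃ Δ : Equiv.Perm (Fin 3) → (L ≃ₗ⁅F⁆ L),
    (∀ σ, Δ σ (C.x (simple 1)) = C.x (simple 1) ∧ Δ σ (C.x (-simple 1)) = C.x (-simple 1)) ∧
    (∀ σ i, Δ σ (C.x (simple (leg i))) = C.x (simple (leg (σ i))) ∧
      Δ σ (C.x (-simple (leg i))) = C.x (-simple (leg (σ i)))) ∧
    ∀ σ (y : C.g1), ((δ σ y : C.g1) : L) = Δ σ y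

end

/-! ### Extension of scalars -/

section

variable {F L : Type*} [Field F] [LieRing L] [LieAlgebra F L] (C : ChevalleyBasis F L)
variable (K : Type*) [Field K] [Algebra F K]

/-- The Chevalley basis `1 ⊗ hᵢ`, `1 ⊗ x_β` of `K ⊗ L`. -/
def baseChange : ChevalleyBasis K (K ⊗[F] L) where
  basis := C.basis.baseChange K
  lie_h_h i j := by
    simp [C.lie_h_h]
  lie_h_x i β := by
    simp [C.lie_h_x, TensorProduct.tmul_smul]
  lie_x_neg β := by
    simp [C.lie_x_neg, TensorProduct.tmul_sum, TensorProduct.tmul_smul]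
  lie_x_x β γ δ h := by
    obtain ⟨c, hc, h1, h2⟩ := C.lie_x_x β γ δ h
    refine ⟨c, hc, ?_, ?_⟩
    · simp [h1, TensorProduct.tmul_smul]
    · simp [h2, TensorProduct.tmul_smul, TensorProduct.tmul_neg]
  lie_x_x_eq_zero β γ h h' := by
    simp [C.lie_x_x_eq_zero β γ h h']

theorem one_tmul_mem_g1 {y : L} (hy : y ∈ C.g1) :
    (1 : K) ⊗ₜ[F] y ∈ (C.baseChange K).g1 := by
  induction hy using Submodule.span_induction with
  | mem y h =>
    obtain ⟨β, hβ, rfl⟩ := h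
    exact Submodule.subset_span ⟨β, hβ, by simp [x, baseChange]⟩
  | zero => simp
  | add a b _ _ ha hb => rw [TensorProduct.tmul_add]; exact add_mem ha hb
  | smul t a _ ha =>
    have h := (C.baseChange K).g1.smul_mem (algebraMap F K t) ha
    rwa [algebraMap_smul, ← TensorProduct.tmul_smul] at h

/-- The map `𝔤₁ → (K ⊗ 𝔤)₁`, `y ↦ 1 ⊗ y`. -/
def toBaseChange (y : C.g1) : (C.baseChange K).g1 :=
  ⟨(1 : K) ⊗ₜ[F] (y : L), C.one_tmul_mem_g1 K y.2⟩

end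

end ChevalleyBasis

/-! ### Bhargava's space of cubes -/

/-- Bhargava's discriminant of a `2 × 2 × 2` cube `A` (Cayley's hyperdeterminant): the
discriminant of the binary quadratic form `det (M X + N Y)`, where `M = A 0` and `N = A 1` are
two opposite faces of the cube. -/
def cubeDisc {F : Type*} [CommRing F] (A : Fin 2 → Fin 2 → Fin 2 → F) : F :=
  (A 0 0 0 * A 1 1 1 + A 0 1 1 * A 1 0 0 - A 0 0 1 * A 1 1 0 - A 0 1 0 * A 1 0 1) ^ 2
    - 4 * (A 0 0 0 * A 0 1 1 - A 0 0 1 * A 0 1 0) * (A 1 0 0 * A 1 1 1 - A 1 0 1 * A 1 1 0)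

end D4

end

/-!
The root vectors of height one are indexed by triples `s : Fin 3 → Fin 2`: starting from `x_{α₂}`,
one applies `ad x_{αᵢ}` for the outer nodes with `s i = 0`. This fixes the signs (`vec`), and in the
resulting basis `𝔰𝔩₂³` acts on `𝔤₁` as on a tensor product `K² ⊗ K² ⊗ K²`, while diagram
automorphisms permute the tensor factors. The Jacobi identity determines the brackets of `𝔤₁` with
itself and with `𝔤₋₁` up to one sign `κ`, which enters `(ad y)⁴ x_{-ρ}` through `κ² = 1` only, and
expanding this expression gives six times the hyperdeterminant (`quartic_ofCube`). Hence everything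
reduces to cubes.

The diagram automorphism of a permutation `σ` is the linear map that permutes a basis of `𝔤`
adapted to `vec` (`diagramMap`). The elements whose brackets it respects form a Lie subalgebra, so
it suffices to compare brackets with `x_{±αᵢ}` for the outer nodes, `x_{α₂}` and `x_{-ρ}`
(`diagramMap_lie`).

For the stabilizer of the hyperdeterminant over a separably closed field, let `g` be an element of
it. A cube `y` of discriminant one lies in the `⟨SL₂³, μ₄⟩`-orbit of
`e₀ ⊗ e₀ ⊗ e₀ + e₁ ⊗ e₁ ⊗ e₁`, since the binary form `det (M X + N Y)` of its faces splits
(`exists_eq_smul_tensorAction`); so `g` may be assumed to fix this base point. The Taylor expansion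
of the hyperdeterminant at the base point then provides a linear form, a quadratic form and a cubic
form that `g` preserves; the latter two only on the kernel of the linear form, which has dimension
seven. The radical of the cubic form on this kernel is a line, and on the orthogonal complement of
this line the forms are `∑ bᵢ cᵢ` and `b₀ b₁ b₂ + c₀ c₁ c₂` in coordinates `(b, c) ∈ K³ ⊕ K³`. The
six coordinate lines are therefore permuted (`FixesBase.apply_tensor`). Up to the exchange of `b`
and `c`, which `⟨SL₂³, μ₄⟩` contains (`exists_swap`), the permutation comes from `S₃`, and what
remains is a torus element of `SL₂³` (`exists_decomposition`).

Finally, a quartic form in characteristic other than `2` and `3` is determined by its values on the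
five points `0, ±1, ±2` in each variable, so an automorphism over `F` that preserves `q` still does
so after an extension of scalars (`mem_stab_iff_baseChange`).
-/

namespace D4

/-! ### Cubes and the tensor action -/

/-- The space `R² ⊗ R² ⊗ R²` of cubes; a basis tensor `e_{s 0} ⊗ e_{s 1} ⊗ e_{s 2}` is recorded
by the triple `s`. Indexing by functions makes the permutations of the three factors visible. -/
abbrev Cube (R : Type*) := (Fin 3 → Fin 2) → R

/-- The basis tensor of `R² ⊗ R² ⊗ R²` that belongs to `s`. -/
abbrev tensor {R : Type*} [Zero R] [One R] (s : Fin 3 → Fin 2) : Cube R := Pi.single s 1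

/-- Cayley's hyperdeterminant of a cube that is indexed by triples. -/
def hdet {R : Type*} [CommRing R] (y : Cube R) : R := cubeDisc fun i j k => y ![i, j, k]

theorem hdet_eq {R : Type*} [CommRing R] (y : Cube R) : hdet y =
    (y ![0, 0, 0] * y ![1, 1, 1] + y ![0, 1, 1] * y ![1, 0, 0] - y ![0, 0, 1] * y ![1, 1, 0]
      - y ![0, 1, 0] * y ![1, 0, 1]) ^ 2
    - 4 * (y ![0, 0, 0] * y ![0, 1, 1] - y ![0, 0, 1] * y ![0, 1, 0])
      * (y ![1, 0, 0] * y ![1, 1, 1] - y ![1, 0, 1] * y ![1, 1, 0]) := rfl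

theorem forall_triple {P : (Fin 3 → Fin 2) → Prop} : (∀ s, P s) ↔
    P ![0, 0, 0] ∧ P ![1, 1, 1] ∧ P ![1, 0, 0] ∧ P ![0, 1, 0] ∧ P ![0, 0, 1] ∧
      P ![0, 1, 1] ∧ P ![1, 0, 1] ∧ P ![1, 1, 0] := by
  refine ⟨fun h => by simp [h], fun h s => ?_⟩
  have hs : s = ![0, 0, 0] ∨ s = ![1, 1, 1] ∨ s = ![1, 0, 0] ∨ s = ![0, 1, 0] ∨ s = ![0, 0, 1] ∨
      s = ![0, 1, 1] ∨ s = ![1, 0, 1] ∨ s = ![1, 1, 0] := by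
    revert s; decide
  rcases hs with rfl | rfl | rfl | rfl | rfl | rfl | rfl | rfl <;> tauto

theorem sum_triple {M : Type*} [AddCommMonoid M] (f : (Fin 3 → Fin 2) → M) : ∑ s, f s =
    f ![0, 0, 0] + (f ![1, 1, 1] + (f ![1, 0, 0] + (f ![0, 1, 0] + (f ![0, 0, 1] +
      (f ![0, 1, 1] + (f ![1, 0, 1] + f ![1, 1, 0])))))) := by
  have h : (Finset.univ : Finset (Fin 3 → Fin 2)) = {![0, 0, 0], ![1, 1, 1], ![1, 0, 0],
      ![0, 1, 0], ![0, 0, 1], ![0, 1, 1], ![1, 0, 1], ![1, 1, 0]} := by decide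
  rw [h]
  repeat rw [Finset.sum_insert (by decide)]
  rw [Finset.sum_singleton]

theorem update_triple {α : Type*} (a b c x : α) :
    Function.update ![a, b, c] 0 x = ![x, b, c] ∧ Function.update ![a, b, c] 1 x = ![a, x, c] ∧
      Function.update ![a, b, c] 2 x = ![a, b, x] := by
  refine ⟨?_, ?_, ?_⟩ <;> ext i <;> fin_cases i <;> rfl

/-- The matrix of `A₀ ⊗ A₁ ⊗ A₂` on cubes. -/
def tensorMatrix (R : Type*) [CommRing R] : (Fin 3 → Matrix (Fin 2) (Fin 2) R) →*
    Matrix (Fin 3 → Fin 2) (Fin 3 → Fin 2) R where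
  toFun A := Matrix.of fun s t => ∏ i, A i (s i) (t i)
  map_one' := by
    ext s t
    by_cases h : s = t
    · subst h
      simp [Matrix.one_apply_eq]
    · obtain ⟨i, hi⟩ := Function.ne_iff.mp h
      rw [Matrix.one_apply_ne h]
      have h1 : (1 : Fin 3 → Matrix (Fin 2) (Fin 2) R) i (s i) (t i) = 0 := Matrix.one_apply_ne hi
      rw [Matrix.of_apply]
      exact Finset.prod_eq_zero (f := fun i => (1 : Fin 3 → Matrix (Fin 2) (Fin 2) R) i (s i) (t i))
        (Finset.mem_univ i) h1
  map_mul' A B := by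
    ext s t
    simp only [Matrix.of_apply, Pi.mul_apply, Matrix.mul_apply, Finset.prod_univ_sum,
      Finset.prod_mul_distrib, Fintype.piFinset_univ]

section action

variable (K : Type*) [Field K]

/-- The action of `SL₂³` on cubes. -/
noncomputable def tensorAction :
    (Fin 3 → Matrix.SpecialLinearGroup (Fin 2) K) →* (Cube K ≃ₗ[K] Cube K) :=
  (LinearMap.GeneralLinearGroup.generalLinearEquiv K (Cube K)).toMonoidHom.comp <|
    MonoidHom.toHomUnits <|
      ((Matrix.toLinAlgEquiv' (R := K) (n := Fin 3 → Fin 2) :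
          Matrix (Fin 3 → Fin 2) (Fin 3 → Fin 2) K →* (Cube K →ₗ[K] Cube K)).comp
        (tensorMatrix K)).comp
      (Matrix.SpecialLinearGroup.coeMonoidHom.compLeft (Fin 3))

variable {K}

theorem tensorAction_apply (A : Fin 3 → Matrix.SpecialLinearGroup (Fin 2) K) (y : Cube K)
    (s : Fin 3 → Fin 2) :
    tensorAction K A y s = ∑ t, (∏ i, (A i : Matrix (Fin 2) (Fin 2) K) (s i) (t i)) * y t :=
  rfl

theorem tensorAction_mulSingle (i : Fin 3) (A : Matrix.SpecialLinearGroup (Fin 2) K) (y : Cube K)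
    (s : Fin 3 → Fin 2) : tensorAction K (Pi.mulSingle i A) y s =
      A (s i) 0 * y (Function.update s i 0) + A (s i) 1 * y (Function.update s i 1) := by
  rw [tensorAction_apply, sum_triple]
  have hm : ∀ a b : Fin 2, ((1 : Matrix.SpecialLinearGroup (Fin 2) K) :
    Matrix (Fin 2) (Fin 2) K) a b = if a = b then 1 else 0 := fun a b => by
      simp [Matrix.one_apply]
  revert s
  rw [forall_triple]
  fin_cases i <;> simp [Fin.prod_univ_three, Pi.mulSingle_apply, hm, update_triple, add_comm]

theorem eq_mulSingle_mul {G : Type*} [Monoid G] (A : Fin 3 → G) :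
    A = Pi.mulSingle 0 (A 0) * (Pi.mulSingle 1 (A 1) * Pi.mulSingle 2 (A 2)) := by
  ext i
  fin_cases i <;> simp

theorem hdet_tensorAction (A : Fin 3 → Matrix.SpecialLinearGroup (Fin 2) K) (y : Cube K) :
    hdet (tensorAction K A y) = hdet y := by
  have h : ∀ (i : Fin 3) (B : Matrix.SpecialLinearGroup (Fin 2) K) (z : Cube K),
      hdet (tensorAction K (Pi.mulSingle i B) z) = hdet z := by
    intro i B z
    have hB : B 0 0 * B 1 1 - B 0 1 * B 1 0 = 1 := by
      rw [← Matrix.det_fin_two]; exact B.2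
    simp only [hdet_eq, tensorAction_mulSingle]
    fin_cases i
    all_goals
      simp only [Fin.zero_eta, Fin.mk_one, Fin.reduceFinMk, update_triple, Matrix.cons_val_zero,
        Matrix.cons_val_one, Matrix.cons_val]
      linear_combination
        (B 0 0 * B 1 1 - B 0 1 * B 1 0 + 1) * hdet z * hB
          - ((B 0 0 * B 1 1 - B 0 1 * B 1 0) ^ 2 - 1) * hdet_eq z
  rw [eq_mulSingle_mul A, map_mul, map_mul]
  simp [h]

variable (K) in
/-- The permutations of the three tensor factors. -/
def permAction : Equiv.Perm (Fin 3) →* (Cube K ≃ₗ[K] Cube K) where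
  toFun σ := LinearEquiv.funCongrLeft K K (σ.arrowCongr (Equiv.refl (Fin 2))).symm
  map_one' := rfl
  map_mul' _ _ := rfl

theorem permAction_apply (σ : Equiv.Perm (Fin 3)) (y : Cube K) (s : Fin 3 → Fin 2) :
    permAction K σ y s = y (s ∘ σ) := rfl

end action

/-! ### Cubes of discriminant one -/

section normalForm

variable {K : Type*} [Field K]

/-- A binary quadratic form of discriminant one has two isotropic lines; suitable vectors on them
are the rows of a matrix of determinant one. -/
theorem exists_isotropic_rows (h2 : (2 : K) ≠ 0) {p r s : K} (h : r ^ 2 - 4 * p * s = 1) :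
    ∃ B : Matrix.SpecialLinearGroup (Fin 2) K,
      ∀ i, p * B i 0 ^ 2 + r * (B i 0 * B i 1) + s * B i 1 ^ 2 = 0 := by
  by_cases hp : p = 0
  · subst hp
    refine ⟨⟨!![1, 0; -s * r, 1], by simp⟩, fun i => ?_⟩
    fin_cases i
    · simp
    · simp only [Fin.mk_one, Matrix.of_apply, Matrix.cons_val_one, Matrix.cons_val_zero]
      linear_combination -s * h
  · have h4 : (4 : K) ≠ 0 := by
      rw [show (4 : K) = 2 * 2 by norm_num]; exact mul_ne_zero h2 h2
    refine ⟨⟨!![(1 - r) / (4 * p), 1 / 2; -r - 1, 2 * p], ?_⟩, fun i => ?_⟩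
    · rw [Matrix.det_fin_two_of]
      field_simp
      ring
    · fin_cases i
      · simp only [Fin.zero_eta, Matrix.of_apply, Matrix.cons_val_one, Matrix.cons_val_zero]
        field_simp
        linear_combination -4 * h
      · simp only [Fin.mk_one, Matrix.of_apply, Matrix.cons_val_one, Matrix.cons_val_zero]
        linear_combination -p * h

theorem exists_rank_one {m : Fin 2 → Fin 2 → K} (h : m 0 0 * m 1 1 = m 0 1 * m 1 0) :
    ∃ a b : Fin 2 → K, ∀ j k, m j k = a j * b k := by
  by_cases hm : ∃ i j, m i j ≠ 0
  · obtain ⟨i, j, hij⟩ := hm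
    refine ⟨fun l => m l j, fun k => m i k / m i j, fun l k => ?_⟩
    have : m l k * m i j = m l j * m i k := by
      fin_cases i <;> fin_cases j <;> fin_cases l <;> fin_cases k <;> simp <;> grind
    field_simp
    exact this
  · push Not at hm
    exact ⟨0, 0, fun j k => by simp [hm]⟩

/-- The base point `e₀ ⊗ e₀ ⊗ e₀ + e₁ ⊗ e₁ ⊗ e₁`, a cube of discriminant `1`. -/
def baseCube (K : Type*) [Field K] : Cube K := tensor ![0, 0, 0] + tensor ![1, 1, 1]

/-- A cube of discriminant one both of whose faces in the first direction are singular lies in the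
`SL₂³`-orbit of a diagonal cube. -/
theorem exists_tensorAction_of_faces {y : Cube K} (hy : hdet y = 1)
    (h : ∀ i, y ![i, 0, 0] * y ![i, 1, 1] = y ![i, 0, 1] * y ![i, 1, 0]) :
    ∃ (A : _) (ε : K), ε ^ 2 = 1 ∧
      y = tensorAction K A (tensor ![0, 0, 0] + ε • tensor ![1, 1, 1]) := by
  obtain ⟨a, b, hab⟩ := exists_rank_one (m := fun j k => y ![0, j, k]) (h 0)
  obtain ⟨c, d, hcd⟩ := exists_rank_one (m := fun j k => y ![1, j, k]) (h 1)
  have hΔ : ((a 0 * c 1 - a 1 * c 0) * (b 0 * d 1 - b 1 * d 0)) ^ 2 = 1 := by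
    rw [← hy, hdet_eq]
    simp only [hab, hcd]
    ring
  have h1 : a 0 * c 1 - a 1 * c 0 ≠ 0 := by rintro h; simp [h] at hΔ
  have h2 : b 0 * d 1 - b 1 * d 0 ≠ 0 := by rintro h; simp [h] at hΔ
  set Δ := a 0 * c 1 - a 1 * c 0 with hΔ1
  set Δ' := b 0 * d 1 - b 1 * d 0 with hΔ2
  let P : Matrix.SpecialLinearGroup (Fin 2) K := ⟨!![a 0, c 0 / Δ; a 1, c 1 / Δ], by
    rw [Matrix.det_fin_two_of]; field_simp; rw [hΔ1]; ring⟩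
  let Q : Matrix.SpecialLinearGroup (Fin 2) K := ⟨!![b 0, d 0 / Δ'; b 1, d 1 / Δ'], by
    rw [Matrix.det_fin_two_of]; field_simp; rw [hΔ2]; ring⟩
  refine ⟨![1, P, Q], Δ * Δ', hΔ, funext ?_⟩
  have hP : (P : Matrix (Fin 2) (Fin 2) K) = !![a 0, c 0 / Δ; a 1, c 1 / Δ] := rfl
  have hQ : (Q : Matrix (Fin 2) (Fin 2) K) = !![b 0, d 0 / Δ'; b 1, d 1 / Δ'] := rfl
  rw [forall_triple]
  simp [tensorAction_apply, sum_triple, Fin.prod_univ_three, hP, hQ, hab, hcd, Pi.single_apply,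
    Matrix.one_apply]
  refine ⟨?_, ?_, ?_, ?_⟩ <;> field_simp

variable [IsSepClosed K]

/-- `⟨SL₂³, μ₄⟩` acts transitively on the cubes of discriminant one. The discriminant of the
binary form `det (x M + y N)` being a square, that form splits, so an element of the first `SL₂`
turns both faces into matrices of rank one. -/
theorem exists_eq_smul_tensorAction (h2 : (2 : K) ≠ 0) {y : Cube K} (hy : hdet y = 1) :
    ∃ (A : _) (ζ : K), ζ ^ 4 = 1 ∧ y = ζ • tensorAction K A (baseCube K) := by
  have : NeZero (2 : K) := ⟨h2⟩
  obtain ⟨B, hB⟩ := exists_isotropic_rows h2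
    (p := y ![0, 0, 0] * y ![0, 1, 1] - y ![0, 0, 1] * y ![0, 1, 0])
    (s := y ![1, 0, 0] * y ![1, 1, 1] - y ![1, 0, 1] * y ![1, 1, 0]) (by rw [← hy, hdet_eq])
  obtain ⟨A, ε, hε, h⟩ :=
    exists_tensorAction_of_faces (y := tensorAction K (Pi.mulSingle 0 B) y)
      (by rw [hdet_tensorAction, hy]) (fun i => by
        simp only [tensorAction_mulSingle, Matrix.cons_val_zero, update_triple]
        linear_combination hB i)
  have hy' : y = tensorAction K ((Pi.mulSingle 0 B)⁻¹ * A)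
      (tensor ![0, 0, 0] + ε • tensor ![1, 1, 1]) := by
    rw [map_mul, LinearEquiv.mul_apply, ← h, ← LinearEquiv.mul_apply, ← map_mul]
    simp
  generalize (Pi.mulSingle 0 B)⁻¹ * A = A' at hy'
  rcases mul_self_eq_one_iff.mp ((sq ε).symm.trans hε) with rfl | rfl
  · exact ⟨A', 1, one_pow 4, by simpa only [one_smul, baseCube] using hy'⟩
  · obtain ⟨ζ, hζ⟩ := IsSepClosed.exists_eq_mul_self (-1 : K)
    let D : Matrix.SpecialLinearGroup (Fin 2) K := ⟨!![-ζ, 0; 0, ζ], by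
      rw [Matrix.det_fin_two_of]; linear_combination hζ⟩
    have hD : (D : Matrix (Fin 2) (Fin 2) K) = !![-ζ, 0; 0, ζ] := rfl
    refine ⟨A' * Pi.mulSingle 0 D, ζ, by grind, ?_⟩
    rw [hy', map_mul (tensorAction K), LinearEquiv.mul_apply, ← map_smul]
    congr 1
    funext s
    revert s
    rw [forall_triple]
    simp [tensorAction_mulSingle, update_triple, baseCube, ← hζ, hD]

end normalForm

/-! ### The stabilizer of the base point -/

/-- The triples with exactly one entry `1`. -/
def unitTriple : Fin 3 → Fin 3 → Fin 2 := ![![1, 0, 0], ![0, 1, 0], ![0, 0, 1]]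

/-- The triples with exactly one entry `0`. -/
def counitTriple : Fin 3 → Fin 3 → Fin 2 := ![![0, 1, 1], ![1, 0, 1], ![1, 1, 0]]

section stabilizer

variable {K : Type*} [Field K]

/-- Up to a factor, the quadratic part of `hdet (baseCube + z)` on the hyperplane where the linear
part vanishes. -/
def quadPart (z : Cube K) : K :=
  z ![0, 0, 0] ^ 2 + z ![1, 0, 0] * z ![0, 1, 1] + z ![0, 1, 0] * z ![1, 0, 1] +
    z ![0, 0, 1] * z ![1, 1, 0]

/-- Up to a factor, the cubic part of `hdet (baseCube + z)` on the hyperplane where the linear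
part vanishes. -/
def cubicPart (z : Cube K) : K :=
  z ![1, 0, 0] * z ![0, 1, 0] * z ![0, 0, 1] + z ![0, 1, 1] * z ![1, 0, 1] * z ![1, 1, 0]

/-- The polar form of `quadPart`. -/
def quadPolar (x y : Cube K) : K := quadPart (x + y) - quadPart x - quadPart y

/-- The full polarization of `cubicPart`. -/
def cubicPolar (x y z : Cube K) : K :=
  cubicPart (x + y + z) - cubicPart (x + y) - cubicPart (x + z) - cubicPart (y + z)
    + cubicPart x + cubicPart y + cubicPart z

/-- The hyperplane on which the linear part of `hdet (baseCube + z)` vanishes. -/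
def Traceless (z : Cube K) : Prop := z ![0, 0, 0] + z ![1, 1, 1] = 0

theorem Traceless.add {x y : Cube K} (hx : Traceless x) (hy : Traceless y) :
    Traceless (x + y) := by
  unfold Traceless at *
  simp only [Pi.add_apply]
  linear_combination hx + hy

theorem traceless_unit (i : Fin 3) : Traceless (tensor (unitTriple i) : Cube K) := by
  fin_cases i <;> simp [Traceless, unitTriple]

theorem traceless_counit (i : Fin 3) : Traceless (tensor (counitTriple i) : Cube K) := by
  fin_cases i <;> simp [Traceless, counitTriple]

theorem quadPolar_eq (x y : Cube K) : quadPolar x y =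
    2 * (x ![0, 0, 0] * y ![0, 0, 0]) +
    (x ![1, 0, 0] * y ![0, 1, 1] + x ![0, 1, 1] * y ![1, 0, 0]) +
    (x ![0, 1, 0] * y ![1, 0, 1] + x ![1, 0, 1] * y ![0, 1, 0]) +
    (x ![0, 0, 1] * y ![1, 1, 0] + x ![1, 1, 0] * y ![0, 0, 1]) := by
  simp only [quadPolar, quadPart, Pi.add_apply]
  ring

theorem cubicPolar_eq (x y z : Cube K) : cubicPolar x y z =
    x ![1, 0, 0] * (y ![0, 1, 0] * z ![0, 0, 1] + y ![0, 0, 1] * z ![0, 1, 0]) +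
    x ![0, 1, 0] * (y ![1, 0, 0] * z ![0, 0, 1] + y ![0, 0, 1] * z ![1, 0, 0]) +
    x ![0, 0, 1] * (y ![1, 0, 0] * z ![0, 1, 0] + y ![0, 1, 0] * z ![1, 0, 0]) +
    x ![0, 1, 1] * (y ![1, 0, 1] * z ![1, 1, 0] + y ![1, 1, 0] * z ![1, 0, 1]) +
    x ![1, 0, 1] * (y ![0, 1, 1] * z ![1, 1, 0] + y ![1, 1, 0] * z ![0, 1, 1]) +
    x ![1, 1, 0] * (y ![0, 1, 1] * z ![1, 0, 1] + y ![1, 0, 1] * z ![0, 1, 1]) := by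
  simp only [cubicPolar, cubicPart, Pi.add_apply]
  ring

/-- The radical of the cubic part is a line. -/
theorem eq_smul_of_cubicPolar_eq_zero {w : Cube K} (hw : Traceless w)
    (key : ∀ y z, Traceless y → Traceless z → cubicPolar w y z = 0) :
    w = w ![0, 0, 0] • (tensor ![0, 0, 0] - tensor ![1, 1, 1]) := by
  have hu := fun i j : Fin 3 => key _ _ (traceless_unit i) (traceless_unit j)
  have hc := fun i j : Fin 3 => key _ _ (traceless_counit i) (traceless_counit j)
  unfold Traceless at hw
  funext s
  revert s
  rw [forall_triple]
  refine ⟨by simp, by simp; linear_combination hw, ?_, ?_, ?_, ?_, ?_, ?_⟩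
  · simpa [cubicPolar_eq, unitTriple] using hu 1 2
  · simpa [cubicPolar_eq, unitTriple] using hu 0 2
  · simpa [cubicPolar_eq, unitTriple] using hu 0 1
  · simpa [cubicPolar_eq, counitTriple] using hc 1 2
  · simpa [cubicPolar_eq, counitTriple] using hc 0 2
  · simpa [cubicPolar_eq, counitTriple] using hc 0 1

theorem hdet_baseCube_add_smul (t : K) (z : Cube K) : hdet (baseCube K + t • z) =
    1 + t * (2 * (z ![0, 0, 0] + z ![1, 1, 1])) +
    t ^ 2 * (3 * (z ![0, 0, 0] + z ![1, 1, 1]) ^ 2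
      - 2 * z ![1, 1, 1] * (z ![0, 0, 0] + z ![1, 1, 1]) - 2 * quadPart z) +
    t ^ 3 * (2 * (z ![0, 0, 0] + z ![1, 1, 1])
      * (z ![0, 0, 0] * z ![1, 1, 1] - quadPart z + z ![0, 0, 0] ^ 2) + 4 * cubicPart z) +
    t ^ 4 * hdet z := by
  simp [hdet_eq, quadPart, cubicPart, baseCube]
  ring

/-- A polynomial `p t + q t² + r t³` is determined by its values at `1`, `-1` and `2`. -/
theorem coeffs_eq_of_forall_eq (h2 : (2 : K) ≠ 0) (h3 : (3 : K) ≠ 0) {p q r p' q' r' : K}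
    (h : ∀ t : K, t * p + t ^ 2 * q + t ^ 3 * r = t * p' + t ^ 2 * q' + t ^ 3 * r') :
    p = p' ∧ q = q' ∧ r = r' := by
  have h6 : (2 * 3 : K) ≠ 0 := mul_ne_zero h2 h3
  refine ⟨mul_left_cancel₀ h6 ?_, mul_left_cancel₀ h2 ?_, mul_left_cancel₀ h6 ?_⟩
  · linear_combination 6 * h 1 - 2 * h (-1) - h 2
  · linear_combination h 1 + h (-1)
  · linear_combination h 2 - 3 * h 1 - h (-1)

/-- Linear automorphisms that preserve the hyperdeterminant and the base point. -/
structure FixesBase (g : Cube K ≃ₗ[K] Cube K) : Prop where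
  hdet_eq : ∀ z, hdet (g z) = hdet z
  base : g (baseCube K) = baseCube K

namespace FixesBase

variable {g : Cube K ≃ₗ[K] Cube K}

theorem symm (hg : FixesBase g) : FixesBase g.symm where
  hdet_eq z := by rw [← hg.hdet_eq, g.apply_symm_apply]
  base := by rw [g.symm_apply_eq, hg.base]

theorem mul {h : Cube K ≃ₗ[K] Cube K} (hg : FixesBase g) (hh : FixesBase h) :
    FixesBase (g * h) where
  hdet_eq z := by rw [LinearEquiv.mul_apply, hg.hdet_eq, hh.hdet_eq]
  base := by rw [LinearEquiv.mul_apply, hh.base, hg.base]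

/-- The linear, quadratic and cubic part of `hdet` at the base point are preserved, because they are
the coefficients of `hdet (baseCube + t z)` as a polynomial in `t`. -/
theorem parts (h2 : (2 : K) ≠ 0) (h3 : (3 : K) ≠ 0) (hg : FixesBase g) {z : Cube K}
    (hz : Traceless z) :
    Traceless (g z) ∧ quadPart (g z) = quadPart z ∧ cubicPart (g z) = cubicPart z := by
  have h : ∀ t : K, hdet (baseCube K + t • g z) = hdet (baseCube K + t • z) := fun t => by
    rw [← hg.hdet_eq (_ + t • z), map_add, hg.base, map_smul]
  simp only [hdet_baseCube_add_smul, hg.hdet_eq, add_assoc, add_right_inj] at h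
  simp only [← add_assoc, add_left_inj] at h
  obtain ⟨e1, e2, e3⟩ := coeffs_eq_of_forall_eq h2 h3 h
  unfold Traceless at *
  have h4 : (2 * 2 : K) ≠ 0 := mul_ne_zero h2 h2
  have h1 := mul_left_cancel₀ h2 e1
  rw [hz] at h1
  rw [h1, hz] at e2 e3
  refine ⟨h1, mul_left_cancel₀ h2 ?_, mul_left_cancel₀ h4 ?_⟩
  · linear_combination -e2
  · linear_combination e3

theorem traceless (h2 : (2 : K) ≠ 0) (h3 : (3 : K) ≠ 0) (hg : FixesBase g) {z : Cube K}
    (hz : Traceless z) : Traceless (g z) := (hg.parts h2 h3 hz).1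

theorem quadPolar_map (h2 : (2 : K) ≠ 0) (h3 : (3 : K) ≠ 0) (hg : FixesBase g) {x y : Cube K}
    (hx : Traceless x) (hy : Traceless y) : quadPolar (g x) (g y) = quadPolar x y := by
  simp only [quadPolar, ← map_add, (hg.parts h2 h3 hx).2.1, (hg.parts h2 h3 hy).2.1,
    (hg.parts h2 h3 (hx.add hy)).2.1]

theorem cubicPolar_map (h2 : (2 : K) ≠ 0) (h3 : (3 : K) ≠ 0) (hg : FixesBase g)
    {x y z : Cube K} (hx : Traceless x) (hy : Traceless y) (hz : Traceless z) :
    cubicPolar (g x) (g y) (g z) = cubicPolar x y z := by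
  simp only [cubicPolar, ← map_add, (hg.parts h2 h3 hx).2.2, (hg.parts h2 h3 hy).2.2,
    (hg.parts h2 h3 hz).2.2, (hg.parts h2 h3 (hx.add hy)).2.2, (hg.parts h2 h3 (hx.add hz)).2.2,
    (hg.parts h2 h3 (hy.add hz)).2.2, (hg.parts h2 h3 ((hx.add hy).add hz)).2.2]

/-- If `cubicPolar x y` vanishes on the traceless cubes, so does `cubicPolar (g x) (g y)`. -/
theorem cubicPolar_map_eq_zero (h2 : (2 : K) ≠ 0) (h3 : (3 : K) ≠ 0) (hg : FixesBase g)
    {x y : Cube K} (hx : Traceless x) (hy : Traceless y)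
    (h : ∀ z, Traceless z → cubicPolar x y z = 0) {z : Cube K} (hz : Traceless z) :
    cubicPolar (g x) (g y) z = 0 := by
  rw [← g.apply_symm_apply z, hg.cubicPolar_map h2 h3 hx hy (hg.symm.traceless h2 h3 hz)]
  exact h _ (hg.symm.traceless h2 h3 hz)

/-- The radical of the cubic part is preserved. -/
theorem exists_smul_sub (h2 : (2 : K) ≠ 0) (h3 : (3 : K) ≠ 0) (hg : FixesBase g) :
    ∃ c : K, c ^ 2 = 1 ∧ g (tensor ![0, 0, 0] - tensor ![1, 1, 1]) =
      c • (tensor ![0, 0, 0] - tensor ![1, 1, 1]) := by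
  set d : Cube K := tensor ![0, 0, 0] - tensor ![1, 1, 1] with hd
  have htd : Traceless d := by simp [Traceless, hd]
  have key : ∀ y z, Traceless y → Traceless z → cubicPolar (g d) y z = 0 := by
    intro y z hy hz
    rw [← g.apply_symm_apply y]
    refine hg.cubicPolar_map_eq_zero h2 h3 htd (hg.symm.traceless h2 h3 hy) (fun w _ => ?_) hz
    simp [cubicPolar_eq, hd]
  have hs := eq_smul_of_cubicPolar_eq_zero (hg.traceless h2 h3 htd) key
  rw [← hd] at hs
  refine ⟨g d ![0, 0, 0], ?_, hs⟩
  have h := (hg.parts h2 h3 htd).2.1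
  rw [hs] at h
  simpa [quadPart, hd] using h

/-- The orthogonal complement of the radical, with respect to the quadratic part, is preserved. -/
theorem apply_corner_eq_zero (h2 : (2 : K) ≠ 0) (h3 : (3 : K) ≠ 0) (hg : FixesBase g)
    {z : Cube K} (h0 : z ![0, 0, 0] = 0) (h1 : z ![1, 1, 1] = 0) :
    g z ![0, 0, 0] = 0 ∧ g z ![1, 1, 1] = 0 := by
  obtain ⟨c, hc, h⟩ := hg.exists_smul_sub h2 h3
  have hz : Traceless z := by simp [Traceless, h0, h1]
  have hq := hg.quadPolar_map h2 h3 hz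
    (y := tensor ![0, 0, 0] - tensor ![1, 1, 1]) (by simp [Traceless])
  have ht := hg.traceless h2 h3 hz
  unfold Traceless at ht
  rw [h] at hq
  have hc0 : c ≠ 0 := by rintro rfl; simp at hc
  have h00 : g z ![0, 0, 0] = 0 := by simpa [quadPolar_eq, h0, h2, hc0] using hq
  exact ⟨h00, by simpa [h00] using ht⟩

end FixesBase

/-- Let `(zb, zc)` and `(ub, uc)` be vectors of `K³ ⊕ K³`, each of them singular for the cubic form
`b₀b₁b₂ + c₀c₁c₂` and isotropic for `∑ bᵢcᵢ`, whose span is singular and whose pairing is `1`. Then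
a nonzero coordinate of the first is its only one, and the second vector is the dual one. -/
theorem eq_single_of_singular_pair {zb zc ub uc : Fin 3 → K}
    (hzb : ∀ i j, i ≠ j → zb i * zb j = 0) (huc : ∀ i j, i ≠ j → uc i * uc j = 0)
    (hb : ∀ i j, i ≠ j → zb i * ub j + zb j * ub i = 0)
    (hc : ∀ i j, i ≠ j → zc i * uc j + zc j * uc i = 0)
    (hz : ∑ i, zb i * zc i = 0) (hu : ∑ i, ub i * uc i = 0)
    (hzu : ∑ i, (zb i * uc i + zc i * ub i) = 1) {i : Fin 3} (hi : zb i ≠ 0) :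
    zb = Pi.single i (zb i) ∧ zc = 0 ∧ ub = 0 ∧ uc = Pi.single i (zb i)⁻¹ := by
  have hzb' : ∀ j, j ≠ i → zb j = 0 := fun j hj => by simpa [hi] using hzb i j hj.symm
  have hub' : ∀ j, j ≠ i → ub j = 0 := fun j hj => by
    simpa [hi, hzb' j hj] using hb i j hj.symm
  have hzci : zc i = 0 := by
    rw [Fintype.sum_eq_single i fun j hj => by rw [hzb' j hj, zero_mul]] at hz
    simpa [hi] using hz
  have hzc' : zc = 0 := by
    by_contra hne
    obtain ⟨k, hk⟩ := Function.ne_iff.mp hne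
    rw [Pi.zero_apply] at hk
    have hki : k ≠ i := by rintro rfl; exact hk hzci
    have huci : uc i = 0 := by simpa [hk, hzci] using hc k i hki
    rw [Fintype.sum_eq_zero] at hzu
    · exact zero_ne_one hzu
    · intro j
      by_cases hj : j = i
      · subst hj; simp [huci, hzci]
      · simp [hzb' j hj, hub' j hj]
  have hone : zb i * uc i = 1 := by
    rw [Fintype.sum_eq_single i fun j hj => by simp [hzb' j hj, hub' j hj]] at hzu
    simpa [hzci] using hzu
  have huci : uc i ≠ 0 := right_ne_zero_of_mul_eq_one hone
  refine ⟨?_, hzc', ?_, ?_⟩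
  · ext j
    by_cases hj : j = i
    · subst hj; simp
    · simp [hj, hzb' j hj]
  · ext j
    by_cases hj : j = i
    · subst hj
      rw [Fintype.sum_eq_single j fun k hk => by simp [hub' k hk]] at hu
      simpa [huci] using hu
    · exact hub' j hj
  · ext j
    by_cases hj : j = i
    · subst hj; simpa using eq_inv_of_mul_eq_one_right hone
    · simpa [hj, huci] using huc i j (Ne.symm hj)

omit [Field K] in
theorem cube_ext {y z : Cube K} (h0 : y ![0, 0, 0] = z ![0, 0, 0])
    (h1 : y ![1, 1, 1] = z ![1, 1, 1])
    (hu : (fun i => y (unitTriple i)) = fun i => z (unitTriple i))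
    (hc : (fun i => y (counitTriple i)) = fun i => z (counitTriple i)) : y = z := by
  funext s
  revert s
  rw [forall_triple]
  exact ⟨h0, h1, congrFun hu 0, congrFun hu 1, congrFun hu 2, congrFun hc 0, congrFun hc 1,
    congrFun hc 2⟩

theorem unitTriple_inj {i j : Fin 3} : unitTriple i = unitTriple j ↔ i = j := by
  revert i j; decide

theorem counitTriple_inj {i j : Fin 3} : counitTriple i = counitTriple j ↔ i = j := by
  revert i j; decide

theorem unitTriple_ne_counitTriple (i j : Fin 3) : unitTriple i ≠ counitTriple j := by
  revert i j; decide

theorem tensor_corner (i : Fin 3) :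
    (tensor (unitTriple i) : Cube K) ![0, 0, 0] = 0 ∧
    (tensor (unitTriple i) : Cube K) ![1, 1, 1] = 0 ∧
    (tensor (counitTriple i) : Cube K) ![0, 0, 0] = 0 ∧
    (tensor (counitTriple i) : Cube K) ![1, 1, 1] = 0 := by
  fin_cases i <;> simp [unitTriple, counitTriple]

namespace FixesBase

variable {g : Cube K ≃ₗ[K] Cube K}

/-- An element of the stabilizer of the base point permutes the six lines spanned by the
basis tensors other than `e₀ ⊗ e₀ ⊗ e₀` and `e₁ ⊗ e₁ ⊗ e₁`. -/
theorem apply_tensor (h2 : (2 : K) ≠ 0) (h3 : (3 : K) ≠ 0) (hg : FixesBase g) (i : Fin 3) :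
    ∃ (j : Fin 3) (c : K), c ≠ 0 ∧
      ((g (tensor (unitTriple i)) = c • tensor (unitTriple j) ∧
        g (tensor (counitTriple i)) = c⁻¹ • tensor (counitTriple j)) ∨
      (g (tensor (unitTriple i)) = c • tensor (counitTriple j) ∧
        g (tensor (counitTriple i)) = c⁻¹ • tensor (unitTriple j))) := by
  have htz := traceless_unit (K := K) i
  have htu := traceless_counit (K := K) i
  obtain ⟨hz0, hz1⟩ := hg.apply_corner_eq_zero h2 h3 (tensor_corner (K := K) i).1
    (tensor_corner (K := K) i).2.1
  obtain ⟨hu0, hu1⟩ := hg.apply_corner_eq_zero h2 h3 (tensor_corner (K := K) i).2.2.1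
    (tensor_corner (K := K) i).2.2.2
  have hzz : ∀ w, Traceless w →
      cubicPolar (g (tensor (unitTriple i))) (g (tensor (unitTriple i))) w = 0 := fun w hw =>
    hg.cubicPolar_map_eq_zero h2 h3 htz htz (fun v _ => by
      fin_cases i <;> simp [cubicPolar_eq, unitTriple]) hw
  have huu : ∀ w, Traceless w →
      cubicPolar (g (tensor (counitTriple i))) (g (tensor (counitTriple i))) w = 0 := fun w hw =>
    hg.cubicPolar_map_eq_zero h2 h3 htu htu (fun v _ => by
      fin_cases i <;> simp [cubicPolar_eq, counitTriple]) hw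
  have hzu : ∀ w, Traceless w →
      cubicPolar (g (tensor (unitTriple i))) (g (tensor (counitTriple i))) w = 0 := fun w hw =>
    hg.cubicPolar_map_eq_zero h2 h3 htz htu (fun v _ => by
      fin_cases i <;> simp [cubicPolar_eq, unitTriple, counitTriple]) hw
  have qzz := hg.quadPolar_map h2 h3 htz htz
  have quu := hg.quadPolar_map h2 h3 htu htu
  have qzu := hg.quadPolar_map h2 h3 htz htu
  have qzz' : quadPolar (tensor (unitTriple i) : Cube K) (tensor (unitTriple i)) = 0 := by
    fin_cases i <;> simp [quadPolar_eq, unitTriple]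
  have quu' : quadPolar (tensor (counitTriple i) : Cube K) (tensor (counitTriple i)) = 0 := by
    fin_cases i <;> simp [quadPolar_eq, counitTriple]
  have qzu' : quadPolar (tensor (unitTriple i) : Cube K) (tensor (counitTriple i)) = 1 := by
    fin_cases i <;> simp [quadPolar_eq, unitTriple, counitTriple]
  rw [qzz'] at qzz
  rw [quu'] at quu
  rw [qzu'] at qzu
  generalize g (tensor (unitTriple i)) = z at *
  generalize g (tensor (counitTriple i)) = u at *
  have pb : ∀ x y : Cube K, (∀ w, Traceless w → cubicPolar x y w = 0) → ∀ j k, j ≠ k →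
      x (unitTriple j) * y (unitTriple k) + x (unitTriple k) * y (unitTriple j) = 0 := by
    intro x y h j k hjk
    have h0 := h _ (traceless_unit 0)
    have h1 := h _ (traceless_unit 1)
    have h2 := h _ (traceless_unit 2)
    simp [cubicPolar_eq, unitTriple] at h0 h1 h2
    fin_cases j <;> fin_cases k <;> simp [unitTriple] at hjk ⊢ <;> grind
  have pc : ∀ x y : Cube K, (∀ w, Traceless w → cubicPolar x y w = 0) → ∀ j k, j ≠ k →
      x (counitTriple j) * y (counitTriple k) + x (counitTriple k) * y (counitTriple j) = 0 := by
    intro x y h j k hjk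
    have h0 := h _ (traceless_counit 0)
    have h1 := h _ (traceless_counit 1)
    have h2 := h _ (traceless_counit 2)
    simp [cubicPolar_eq, counitTriple] at h0 h1 h2
    fin_cases j <;> fin_cases k <;> simp [counitTriple] at hjk ⊢ <;> grind
  have half : ∀ a b : K, a * b + b * a = 0 → a * b = 0 := fun a b h => by
    have : 2 * (a * b) = 0 := by linear_combination h
    simpa [h2] using this
  rw [quadPolar_eq, hz0] at qzz qzu
  rw [quadPolar_eq, hu0] at quu
  have hzb := fun j k hjk => half _ _ (pb z z hzz j k hjk)
  have hzc := fun j k hjk => half _ _ (pc z z hzz j k hjk)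
  have hub := fun j k hjk => half _ _ (pb u u huu j k hjk)
  have huc := fun j k hjk => half _ _ (pc u u huu j k hjk)
  have sz : ∑ j, z (unitTriple j) * z (counitTriple j) = 0 := by
    rw [Fin.sum_univ_three]
    refine mul_left_cancel₀ h2 ?_
    simp only [unitTriple, counitTriple, Matrix.cons_val_zero, Matrix.cons_val_one,
      Matrix.cons_val]
    linear_combination qzz
  have su : ∑ j, u (unitTriple j) * u (counitTriple j) = 0 := by
    rw [Fin.sum_univ_three]
    refine mul_left_cancel₀ h2 ?_
    simp only [unitTriple, counitTriple, Matrix.cons_val_zero, Matrix.cons_val_one,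
      Matrix.cons_val]
    linear_combination quu
  have szu : ∑ j, (z (unitTriple j) * u (counitTriple j) + z (counitTriple j) * u (unitTriple j))
      = 1 := by
    rw [Fin.sum_univ_three]
    simp only [unitTriple, counitTriple, Matrix.cons_val_zero, Matrix.cons_val_one,
      Matrix.cons_val]
    linear_combination qzu
  have hne : ∃ j, z (unitTriple j) ≠ 0 ∨ z (counitTriple j) ≠ 0 := by
    by_contra! hne
    simp [hne] at szu
  obtain ⟨j, hj | hj⟩ := hne
  · obtain ⟨h1, h2, h3, h4⟩ := eq_single_of_singular_pair hzb huc (pb z u hzu) (pc z u hzu)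
      sz su szu hj
    refine ⟨j, _, hj, Or.inl ⟨cube_ext ?_ ?_ (h1.trans ?_) (h2.trans ?_),
      cube_ext ?_ ?_ (h3.trans ?_) (h4.trans ?_)⟩⟩
    all_goals first
      | simp [tensor_corner, hz0, hz1, hu0, hu1]; done
      | ext k
        simp [Pi.single_apply, unitTriple_inj, counitTriple_inj, unitTriple_ne_counitTriple,
          (unitTriple_ne_counitTriple _ _).symm]
  · obtain ⟨h1, h2, h3, h4⟩ := eq_single_of_singular_pair hzc hub (pc z u hzu) (pb z u hzu)
      (by simpa only [mul_comm] using sz) (by simpa only [mul_comm] using su)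
      (by simpa only [add_comm] using szu) hj
    refine ⟨j, _, hj, Or.inr ⟨cube_ext ?_ ?_ (h2.trans ?_) (h1.trans ?_),
      cube_ext ?_ ?_ (h4.trans ?_) (h3.trans ?_)⟩⟩
    all_goals first
      | simp [tensor_corner, hz0, hz1, hu0, hu1]; done
      | ext k
        simp [Pi.single_apply, unitTriple_inj, counitTriple_inj, unitTriple_ne_counitTriple,
          (unitTriple_ne_counitTriple _ _).symm]

/-- A stabilizing element that is diagonal is a torus element of `SL₂³`. -/
theorem exists_eq_tensorAction [IsSepClosed K] (h2 : (2 : K) ≠ 0) (h3 : (3 : K) ≠ 0)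
    (hg : FixesBase g) {β : Fin 3 → K} (hβ : ∀ i, β i ≠ 0)
    (hu : ∀ i, g (tensor (unitTriple i)) = β i • tensor (unitTriple i))
    (hc : ∀ i, g (tensor (counitTriple i)) = (β i)⁻¹ • tensor (counitTriple i)) :
    ∃ A, g = tensorAction K A := by
  have : NeZero (2 : K) := ⟨h2⟩
  have hprod : β 0 * β 1 * β 2 = 1 := by
    have ht : Traceless (tensor (unitTriple 0) + tensor (unitTriple 1) + tensor (unitTriple 2) :
      Cube K) := ((traceless_unit 0).add (traceless_unit 1)).add (traceless_unit 2)
    have h := (hg.parts h2 h3 ht).2.2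
    rw [map_add, map_add, hu, hu, hu] at h
    simpa [cubicPart, unitTriple] using h
  obtain ⟨c, hc1, hd⟩ := hg.exists_smul_sub h2 h3
  -- the sign of `g` on the radical of the cubic part is seen by the quartic part only
  have hc1 : c = 1 := by
    have h := hg.hdet_eq (tensor ![0, 0, 0] - tensor ![1, 1, 1] + tensor (unitTriple 0) +
      tensor (unitTriple 1) + tensor (unitTriple 2))
    rw [map_add, map_add, map_add, hd, hu, hu, hu] at h
    simp [D4.hdet_eq, unitTriple] at h
    have : 2 * 2 * (c - 1) = 0 := by
      linear_combination -h - 4 * c * hprod + (c ^ 2 + 1) * hc1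
    simpa [h2, sub_eq_zero] using this
  subst hc1
  have h0 : g (tensor ![0, 0, 0]) = tensor ![0, 0, 0] := by
    have hb := hg.base
    rw [baseCube, map_add] at hb
    rw [map_sub, one_smul] at hd
    have : (2 : K) • g (tensor ![0, 0, 0]) = (2 : K) • tensor ![0, 0, 0] := by
      rw [two_smul, two_smul]
      linear_combination (exp := 1) hb + hd
    exact smul_right_injective _ h2 this
  have h1 : g (tensor ![1, 1, 1]) = tensor ![1, 1, 1] := by
    have hb := hg.base
    rwa [baseCube, map_add, h0, add_right_inj] at hb
  obtain ⟨a, ha⟩ := IsSepClosed.exists_eq_mul_self (β 0)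
  obtain ⟨b, hb⟩ := IsSepClosed.exists_eq_mul_self (β 1)
  have ha0 : a ≠ 0 := by rintro rfl; exact hβ 0 (by simpa using ha)
  have hb0 : b ≠ 0 := by rintro rfl; exact hβ 1 (by simpa using hb)
  have hβ2 : β 2 = (a * b)⁻¹ * (a * b)⁻¹ := by
    rw [ha, hb] at hprod
    field_simp
    linear_combination hprod
  have hex : ∀ t : K, ∃ D : Matrix.SpecialLinearGroup (Fin 2) K,
      t ≠ 0 → (D : Matrix (Fin 2) (Fin 2) K) = !![t⁻¹, 0; 0, t] := fun t => by
    by_cases ht : t = 0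
    · exact ⟨1, fun h => absurd ht h⟩
    · exact ⟨⟨!![t⁻¹, 0; 0, t], by rw [Matrix.det_fin_two_of]; field_simp; simp⟩, fun _ => rfl⟩
  choose D hD using hex
  have hab0 : (a * b)⁻¹ ≠ 0 := inv_ne_zero (mul_ne_zero ha0 hb0)
  refine ⟨![D a, D b, D (a * b)⁻¹], ?_⟩
  refine LinearEquiv.toLinearMap_injective ((Pi.basisFun K (Fin 3 → Fin 2)).ext fun s => ?_)
  rw [Pi.basisFun_apply, LinearEquiv.coe_coe, LinearEquiv.coe_coe]
  revert s
  rw [forall_triple]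
  rw [h0, h1]
  have hu0 := hu 0
  have hu1 := hu 1
  have hu2 := hu 2
  have hc0 := hc 0
  have hc1 := hc 1
  have hc2 := hc 2
  simp only [unitTriple, counitTriple, Matrix.cons_val_zero, Matrix.cons_val_one,
      Matrix.cons_val] at hu0 hu1 hu2 hc0 hc1 hc2
  rw [hu0, hu1, hu2, hc0, hc1, hc2, ha, hb, hβ2]
  refine ⟨?_, ?_, ?_, ?_, ?_, ?_, ?_, ?_⟩
  all_goals
    funext s
    revert s
    rw [forall_triple]
    simp [tensorAction_apply, Fin.prod_univ_three, hD, ha0, hb0, Pi.single_apply]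
  all_goals
    field_simp

end FixesBase

/-- If a combination of three basis tensors `π i` has a nonzero coordinate at each of three distinct
`τ j`, the `π i` are the `τ j` in some order. -/
theorem exists_perm_of_product_ne_zero {π : Fin 3 → Fin 3 → Fin 2} {β : Fin 3 → K}
    {τ : Fin 3 → Fin 3 → Fin 2} (hτ : Function.Injective τ)
    (h : ∏ j, (∑ i, β i • tensor (π i) : Cube K) (τ j) ≠ 0) :
    ∃ σ : Equiv.Perm (Fin 3), ∀ i, π i = τ (σ i) := by
  have hex : ∀ j, ∃ i, π i = τ j := by
    intro j
    by_contra! hne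
    refine Finset.prod_ne_zero_iff.mp h j (Finset.mem_univ j) ?_
    rw [Finset.sum_apply]
    exact Finset.sum_eq_zero fun i _ => by simp [(hne i).symm]
  choose f hf using hex
  have hinj : Function.Injective f := fun j k hjk => hτ (by rw [← hf j, ← hf k, hjk])
  let σ := Equiv.ofBijective f (Finite.injective_iff_bijective.mp hinj)
  refine ⟨σ.symm, fun i => ?_⟩
  rw [← hf]
  exact congrArg π (σ.apply_symm_apply i).symm

theorem permAction_tensor (σ : Equiv.Perm (Fin 3)) (s : Fin 3 → Fin 2) :
    permAction K σ (tensor s) = tensor (s ∘ σ.symm) := by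
  funext t
  simp only [permAction_apply, Pi.single_apply]
  refine if_congr ?_ rfl rfl
  rw [Equiv.eq_comp_symm]

theorem unitTriple_comp (σ : Equiv.Perm (Fin 3)) (i : Fin 3) :
    unitTriple i ∘ σ = unitTriple (σ.symm i) := by
  revert σ i; decide

theorem counitTriple_comp (σ : Equiv.Perm (Fin 3)) (i : Fin 3) :
    counitTriple i ∘ σ = counitTriple (σ.symm i) := by
  revert σ i; decide

theorem hdet_permAction (σ : Equiv.Perm (Fin 3)) (y : Cube K) :
    hdet (permAction K σ y) = hdet y := by
  have hs : ∀ a b c : Fin 2, ![a, b, c] ∘ σ =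
      ![![a, b, c] (σ 0), ![a, b, c] (σ 1), ![a, b, c] (σ 2)] := fun a b c => by
    ext i; fin_cases i <;> rfl
  have h01 : σ 0 ≠ σ 1 := by simp
  have h02 : σ 0 ≠ σ 2 := by simp
  have h12 : σ 1 ≠ σ 2 := by simp
  simp only [hdet_eq, permAction_apply, hs]
  generalize σ 0 = a at *
  generalize σ 1 = b at *
  generalize σ 2 = c at *
  clear hs
  fin_cases a <;> fin_cases b <;> fin_cases c <;>
    first | contradiction | (simp; done) | (simp; ring)

theorem fixesBase_permAction (σ : Equiv.Perm (Fin 3)) : FixesBase (permAction K σ) := by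
  have hcomp : ∀ (τ : Equiv.Perm (Fin 3)) (a : Fin 2), ![a, a, a] ∘ τ = ![a, a, a] := by decide
  refine ⟨hdet_permAction σ, ?_⟩
  rw [baseCube, map_add, permAction_tensor, permAction_tensor, hcomp, hcomp]

theorem cubicPart_eq_prod (z : Cube K) :
    cubicPart z = ∏ i, z (unitTriple i) + ∏ i, z (counitTriple i) := by
  simp [cubicPart, Fin.prod_univ_three, unitTriple, counitTriple]

theorem hdet_smul (c : K) (y : Cube K) : hdet (c • y) = c ^ 4 * hdet y := by
  simp only [hdet_eq, Pi.smul_apply, smul_eq_mul]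
  ring

variable [IsSepClosed K]

variable (K) in
/-- The exchange of `e₀` and `e₁` in all three factors belongs to `⟨SL₂³, μ₄⟩`. -/
theorem exists_swap (h2 : (2 : K) ≠ 0) : ∃ (A : _) (ζ : K), ζ ^ 4 = 1 ∧ ∀ (y : Cube K) (i j k),
    (ζ • tensorAction K A y) ![i, j, k] = y ![1 - i, 1 - j, 1 - k] := by
  have : NeZero (2 : K) := ⟨h2⟩
  obtain ⟨ζ, hζ⟩ := IsSepClosed.exists_eq_mul_self (-1 : K)
  let W : Matrix.SpecialLinearGroup (Fin 2) K := ⟨!![0, ζ; ζ, 0], by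
    rw [Matrix.det_fin_two_of]; linear_combination hζ⟩
  have hW : (W : Matrix (Fin 2) (Fin 2) K) = !![0, ζ; ζ, 0] := rfl
  have hζ4 : ζ ^ 4 = 1 := by grind
  refine ⟨fun _ => W, ζ, hζ4, fun y i j k => ?_⟩
  have h4 : ζ * (ζ * ζ * ζ) = 1 := by rw [← hζ4]; ring
  fin_cases i <;> fin_cases j <;> fin_cases k <;>
    simp [tensorAction_apply, sum_triple, hW, Fin.prod_univ_three, ← mul_assoc] <;> grind

/-- A stabilizing element that permutes, up to factors, the basis tensors with exactly one `e₁` is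
a permutation of the tensor factors followed by a torus element. -/
theorem exists_tensorAction_permAction (h2 : (2 : K) ≠ 0) (h3 : (3 : K) ≠ 0)
    {g : Cube K ≃ₗ[K] Cube K} (hg : FixesBase g) {σ : Equiv.Perm (Fin 3)} {c : Fin 3 → K}
    (hc : ∀ i, c i ≠ 0) (hgu : ∀ i, g (tensor (unitTriple i)) = c i • tensor (unitTriple (σ i)))
    (hgc : ∀ i, g (tensor (counitTriple i)) = (c i)⁻¹ • tensor (counitTriple (σ i))) :
    ∃ A, ∀ y, g y = tensorAction K A (permAction K σ y) := by
  have hinv : (σ⁻¹).symm = σ := rfl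
  obtain ⟨A, hA⟩ := (hg.mul (fixesBase_permAction σ⁻¹)).exists_eq_tensorAction h2 h3
    (β := fun i => c (σ.symm i))
    (fun i => hc _)
    (fun i => by
      rw [LinearEquiv.mul_apply, permAction_tensor, hinv, unitTriple_comp, hgu,
        Equiv.apply_symm_apply])
    (fun i => by
      rw [LinearEquiv.mul_apply, permAction_tensor, hinv, counitTriple_comp, hgc,
        Equiv.apply_symm_apply])
  refine ⟨A, fun y => ?_⟩
  rw [← hA, LinearEquiv.mul_apply, ← LinearEquiv.mul_apply (permAction K σ⁻¹), ← map_mul]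
  simp

/-- The value of the cubic part at the sum of the three tensors with exactly one `e₁` is one, which
excludes that the stabilizing element moves some, but not all of them to tensors with exactly one
`e₀`. -/
theorem exists_decomposition_of_fixesBase (h2 : (2 : K) ≠ 0) (h3 : (3 : K) ≠ 0)
    {g : Cube K ≃ₗ[K] Cube K} (hg : FixesBase g) :
    ∃ (A : _) (ζ : K) (σ : _), ζ ^ 4 = 1 ∧
      ∀ y, g y = ζ • tensorAction K A (permAction K σ y) := by
  choose j c hc h using hg.apply_tensor h2 h3
  have hπ : ∀ i, ∃ p, g (tensor (unitTriple i)) = c i • tensor p ∧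
      ((p = unitTriple (j i) ∧ g (tensor (counitTriple i)) =
        (c i)⁻¹ • tensor (counitTriple (j i))) ∨
      (p = counitTriple (j i) ∧ g (tensor (counitTriple i)) =
        (c i)⁻¹ • tensor (unitTriple (j i)))) := fun i =>
    (h i).elim (fun h => ⟨_, h.1, Or.inl ⟨rfl, h.2⟩⟩) (fun h => ⟨_, h.1, Or.inr ⟨rfl, h.2⟩⟩)
  choose π hπ1 hπ2 using hπ
  have hcub : cubicPart (∑ i, c i • tensor (π i) : Cube K) = 1 := by
    have ht : Traceless (∑ i, tensor (unitTriple i) : Cube K) := by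
      rw [Fin.sum_univ_three]
      exact ((traceless_unit 0).add (traceless_unit 1)).add (traceless_unit 2)
    have h := (hg.parts h2 h3 ht).2.2
    rw [map_sum, Finset.sum_congr rfl fun i _ => hπ1 i] at h
    rw [h]
    simp [cubicPart, Fin.sum_univ_three, unitTriple]
  have hsplit : ∏ k, (∑ i, c i • tensor (π i) : Cube K) (unitTriple k) ≠ 0 ∨
      ∏ k, (∑ i, c i • tensor (π i) : Cube K) (counitTriple k) ≠ 0 := by
    by_contra! h0
    rw [cubicPart_eq_prod, h0.1, h0.2, add_zero] at hcub
    exact zero_ne_one hcub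
  rcases hsplit with hs | hs
  · obtain ⟨σ, hσ⟩ := exists_perm_of_product_ne_zero (fun _ _ => unitTriple_inj.mp) hs
    have hgc : ∀ i, g (tensor (counitTriple i)) = (c i)⁻¹ • tensor (counitTriple (σ i)) := by
      intro i
      rcases hπ2 i with ⟨h1, h2⟩ | ⟨h1, -⟩
      · rw [h2, unitTriple_inj.mp ((hσ i).symm.trans h1)]
      · exact absurd ((hσ i).symm.trans h1) (unitTriple_ne_counitTriple _ _)
    obtain ⟨A, hA⟩ := exists_tensorAction_permAction h2 h3 hg hc
      (fun i => by rw [hπ1, hσ]) hgc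
    exact ⟨A, 1, σ, one_pow 4, fun y => by rw [one_smul, hA]⟩
  · obtain ⟨σ, hσ⟩ := exists_perm_of_product_ne_zero (fun _ _ => counitTriple_inj.mp) hs
    have hgc : ∀ i, g (tensor (counitTriple i)) = (c i)⁻¹ • tensor (unitTriple (σ i)) := by
      intro i
      rcases hπ2 i with ⟨h1, -⟩ | ⟨h1, h2⟩
      · exact absurd ((hσ i).symm.trans h1).symm (unitTriple_ne_counitTriple _ _)
      · rw [h2, counitTriple_inj.mp ((hσ i).symm.trans h1)]
    -- composing with the exchange of `e₀` and `e₁` leads back to the first case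
    obtain ⟨B, ζ, hζ, hW⟩ := exists_swap K h2
    have hζ0 : ζ ≠ 0 := by rintro rfl; simp at hζ
    let W := LinearEquiv.smulOfNeZero K (Cube K) ζ hζ0 * tensorAction K B
    have hWapp : ∀ y, W y = ζ • tensorAction K B y := fun y => rfl
    have hWu : ∀ i, W (tensor (unitTriple i)) = tensor (counitTriple i) := by
      intro i
      funext s
      revert s
      rw [forall_triple]
      simp only [hWapp, hW]
      fin_cases i <;> simp [unitTriple, counitTriple]
    have hWc : ∀ i, W (tensor (counitTriple i)) = tensor (unitTriple i) := by
      intro i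
      funext s
      revert s
      rw [forall_triple]
      simp only [hWapp, hW]
      fin_cases i <;> simp [unitTriple, counitTriple]
    have hWfix : FixesBase W := ⟨fun z => by
      rw [hWapp, hdet_smul, hζ, hdet_tensorAction, one_mul], by
      funext s
      revert s
      rw [forall_triple]
      simp only [hWapp, hW]
      simp [baseCube]⟩
    obtain ⟨A, hA⟩ := exists_tensorAction_permAction h2 h3 (hWfix.mul hg) hc (σ := σ)
      (fun i => by rw [LinearEquiv.mul_apply, hπ1, hσ, map_smul, hWc])
      (fun i => by rw [LinearEquiv.mul_apply, hgc, map_smul, hWu])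
    refine ⟨B⁻¹ * A, ζ⁻¹, σ, by rw [inv_pow, hζ, inv_one], fun y => ?_⟩
    rw [map_mul, LinearEquiv.mul_apply, ← hA, LinearEquiv.mul_apply, hWapp, map_smul,
      inv_smul_smul₀ hζ0, ← LinearEquiv.mul_apply, ← map_mul]
    simp

/-- The stabilizer of the hyperdeterminant is contained in `⟨SL₂³, μ₄⟩ S₃`. -/
theorem exists_decomposition (h2 : (2 : K) ≠ 0) (h3 : (3 : K) ≠ 0)
    {g : Cube K ≃ₗ[K] Cube K} (hg : ∀ y, hdet (g y) = hdet y) :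
    ∃ (A : _) (ζ : K) (σ : _), ζ ^ 4 = 1 ∧
      ∀ y, g y = ζ • tensorAction K A (permAction K σ y) := by
  have hb : hdet (g (baseCube K)) = 1 := by
    rw [hg]; simp [hdet_eq, baseCube]
  obtain ⟨A, ζ, hζ, h⟩ := exists_eq_smul_tensorAction h2 hb
  have hζ0 : ζ ≠ 0 := by rintro rfl; simp at hζ
  have hAA : ∀ y, tensorAction K A⁻¹ (tensorAction K A y) = y := fun y => by
    rw [← LinearEquiv.mul_apply, ← map_mul]; simp
  have hAA' : ∀ y, tensorAction K A (tensorAction K A⁻¹ y) = y := fun y => by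
    rw [← LinearEquiv.mul_apply, ← map_mul]; simp
  have hfix : FixesBase (tensorAction K A⁻¹ *
      LinearEquiv.smulOfNeZero K (Cube K) ζ⁻¹ (inv_ne_zero hζ0) * g) := by
    refine ⟨fun z => ?_, ?_⟩
    · change hdet (tensorAction K A⁻¹ (ζ⁻¹ • g z)) = _
      rw [hdet_tensorAction, hdet_smul, inv_pow, hζ, hg, inv_one, one_mul]
    · change tensorAction K A⁻¹ (ζ⁻¹ • g _) = _
      rw [h, inv_smul_smul₀ hζ0, hAA]
  obtain ⟨A', ζ', σ, hζ', h'⟩ := exists_decomposition_of_fixesBase h2 h3 hfix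
  refine ⟨A * A', ζ * ζ', σ, by rw [mul_pow, hζ, hζ', one_mul], fun y => ?_⟩
  rw [map_mul, LinearEquiv.mul_apply, mul_smul, ← map_smul, ← h' y]
  change _ = ζ • tensorAction K A (tensorAction K A⁻¹ (ζ⁻¹ • g y))
  rw [hAA', smul_inv_smul₀ hζ0]

end stabilizer

/-! ### The roots of height one -/

theorem pairing_eq (β γ : Fin 4 → ℤ) : pairing β γ =
    2 * (β 0 * γ 0 + β 1 * γ 1 + β 2 * γ 2 + β 3 * γ 3) - β 1 * (γ 0 + γ 2 + γ 3)
      - γ 1 * (β 0 + β 2 + β 3) := by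
  have h : CartanMatrix.D 4 = !![2, -1, 0, 0; -1, 2, -1, -1; 0, -1, 2, 0; 0, -1, 0, 2] := by
    decide
  simp [pairing, h, dotProduct, Matrix.mulVec, Fin.sum_univ_four]
  ring

/-- The root of height one whose coefficient at the outer node `leg i` is `1` if `s i = 0`, and `0`
if `s i = 1`. With this convention, the root vector of the `i`-th outer node maps `e₁` to `e₀` in
the `i`-th tensor factor, as an upper triangular elementary matrix does. -/
def cubeRoot (s : Fin 3 → Fin 2) : Root :=
  ⟨![if s 0 = 0 then 1 else 0, 1, if s 1 = 0 then 1 else 0, if s 2 = 0 then 1 else 0], by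
    revert s; decide⟩

theorem cubeRoot_injective : Function.Injective cubeRoot := by
  have h : ∀ s t : Fin 3 → Fin 2, (cubeRoot s).1 = (cubeRoot t).1 → s = t := by decide
  exact fun s t hst => h s t (congrArg Subtype.val hst)

theorem height_cubeRoot (s : Fin 3 → Fin 2) : (cubeRoot s).height = 1 := rfl

theorem exists_cubeRoot_eq {β : Root} (hβ : β.height = 1) : ∃ s, cubeRoot s = β := by
  obtain ⟨β, h⟩ := β
  change β 1 = 1 at hβ
  rw [pairing_eq, hβ] at h
  have h01 : ∀ n : ℤ, 0 ≤ n * (n - 1) := fun n => by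
    rcases le_or_gt n 0 with h | h <;> nlinarith
  have hn : ∀ n : ℤ, n * (n - 1) = 0 →
      n = if (if n = 1 then 0 else 1 : Fin 2) = 0 then 1 else 0 := by
    intro n hn
    rcases mul_eq_zero.mp hn with h | h
    · simp [h]
    · simp [sub_eq_zero.mp h]
  have e0 : β 0 * (β 0 - 1) = 0 := by nlinarith [h01 (β 0), h01 (β 2), h01 (β 3)]
  have e2 : β 2 * (β 2 - 1) = 0 := by nlinarith [h01 (β 0), h01 (β 2), h01 (β 3)]
  have e3 : β 3 * (β 3 - 1) = 0 := by nlinarith [h01 (β 0), h01 (β 2), h01 (β 3)]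
  refine ⟨![if β 0 = 1 then 0 else 1, if β 2 = 1 then 0 else 1, if β 3 = 1 then 0 else 1],
    Subtype.ext (funext fun i => ?_)⟩
  fin_cases i
  · exact (hn _ e0).symm
  · exact hβ.symm
  · exact (hn _ e2).symm
  · exact (hn _ e3).symm

theorem pairing_cubeRoot (s t : Fin 3 → Fin 2) :
    pairing (cubeRoot s).1 (cubeRoot t).1 = 2 - ∑ i, if s i = t i then 0 else 1 := by
  revert s t; decide

namespace ChevalleyBasis

variable {F L : Type*} [Field F] [LieRing L] [LieAlgebra F L] (C : ChevalleyBasis F L)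

/-! ### Brackets of the grade one part -/

theorem lie_x_x_of_ne {β γ : Root} (h0 : β.1 + γ.1 ≠ 0)
    (h : pairing (β.1 + γ.1) (β.1 + γ.1) ≠ 2) : ⁅C.x β, C.x γ⁆ = 0 :=
  C.lie_x_x_eq_zero β γ h0 fun ⟨δ, hδ⟩ => h (hδ ▸ δ.2)

theorem lie_x_x_of_eq {β γ δ : Root} (h : β.1 + γ.1 = δ.1) :
    ∃ c : F, c * c = 1 ∧ ⁅C.x β, C.x γ⁆ = c • C.x δ := by
  obtain ⟨c, hc, h1, -⟩ := C.lie_x_x β γ δ h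
  refine ⟨c, ?_, by rw [Int.cast_smul_eq_zsmul]; exact h1⟩
  rcases hc with rfl | rfl <;> simp

/-- The coroot of `β`, expressed in the `hᵢ`. -/
noncomputable def coroot (β : Fin 4 → ℤ) : L := ∑ i, β i • C.basis (.inl i)

theorem lie_coroot_x (β : Fin 4 → ℤ) (γ : Root) :
    ⁅C.coroot β, C.x γ⁆ = pairing γ.1 β • C.x γ := by
  have h : ∀ i, ⁅C.basis (.inl i), C.x γ⁆ = pairing γ.1 (simple i).1 • C.x γ :=
    fun i => C.lie_h_x i γ
  simp only [coroot, Fin.sum_univ_four, add_lie, zsmul_lie, h, smul_smul, ← add_smul]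
  congr 1
  simp [pairing_eq, simple]
  ring

/-- The root vector of the `i`-th outer node. -/
noncomputable def e (i : Fin 3) : L := C.x (simple (leg i))

/-- The negative root vector of the `i`-th outer node. -/
noncomputable def f (i : Fin 3) : L := C.x (-simple (leg i))

/-- `[e i, y]` or `y`, as `a` is `0` or `1`. -/
noncomputable def raise (i : Fin 3) (a : Fin 2) (y : L) : L := if a = 0 then ⁅C.e i, y⁆ else y

/-- The basis vector of `𝔤₁` that corresponds to the basis tensor of index `s`: up to sign it is
the root vector of `cubeRoot s`, and the signs are chosen so that the `e i` act without signs. -/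
noncomputable def vec (s : Fin 3 → Fin 2) : L :=
  C.raise 0 (s 0) (C.raise 1 (s 1) (C.raise 2 (s 2) (C.x (simple 1))))

theorem lie_e_e (i j : Fin 3) : ⁅C.e i, C.e j⁆ = 0 := by
  refine C.lie_x_x_of_ne ?_ ?_ <;> (revert i j; decide)

theorem lie_e_lie_e (i j : Fin 3) (y : L) : ⁅C.e i, ⁅C.e j, y⁆⁆ = ⁅C.e j, ⁅C.e i, y⁆⁆ := by
  rw [leibniz_lie, C.lie_e_e, zero_lie, zero_add]

theorem lie_e_raise {i j : Fin 3} (a : Fin 2) (y : L) :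
    ⁅C.e i, C.raise j a y⁆ = C.raise j a ⁅C.e i, y⁆ := by
  unfold raise
  split_ifs
  · rw [C.lie_e_lie_e]
  · rfl

theorem lie_e_vec_of_eq_one {s : Fin 3 → Fin 2} {i : Fin 3} (h : s i = 1) :
    ⁅C.e i, C.vec s⁆ = C.vec (Function.update s i 0) := by
  fin_cases i <;> simp only [Fin.zero_eta, Fin.mk_one, Fin.reduceFinMk] at h ⊢
  · simp [vec, raise, h]
  · rw [vec, C.lie_e_raise]
    simp [vec, raise, h]
  · rw [vec, C.lie_e_raise, C.lie_e_raise]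
    simp [vec, raise, h]

theorem exists_vec_eq (s : Fin 3 → Fin 2) :
    ∃ c : F, c * c = 1 ∧ C.vec s = c • C.x (cubeRoot s) := by
  have step : ∀ (s : Fin 3 → Fin 2) (i : Fin 3), s i = 1 →
      (∃ c : F, c * c = 1 ∧ C.vec s = c • C.x (cubeRoot s)) →
      ∃ c : F, c * c = 1 ∧ C.vec (Function.update s i 0) =
        c • C.x (cubeRoot (Function.update s i 0)) := by
    have hroot : ∀ (s : Fin 3 → Fin 2) (i : Fin 3), s i = 1 →
        (simple (leg i)).1 + (cubeRoot s).1 = (cubeRoot (Function.update s i 0)).1 := by decide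
    rintro s i h ⟨c, hc, hs⟩
    obtain ⟨d, hd, hd'⟩ := C.lie_x_x_of_eq (β := simple (leg i)) (γ := cubeRoot s)
      (δ := cubeRoot (Function.update s i 0)) (hroot s i h)
    refine ⟨c * d, by linear_combination d * d * hc + hd, ?_⟩
    rw [← C.lie_e_vec_of_eq_one h, hs, lie_smul, e, hd', smul_smul]
  have h111 : ∃ c : F, c * c = 1 ∧ C.vec ![1, 1, 1] = c • C.x (cubeRoot ![1, 1, 1]) := by
    refine ⟨1, one_mul 1, ?_⟩
    have : cubeRoot ![1, 1, 1] = simple 1 := Subtype.ext (by decide)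
    rw [one_smul, this]
    rfl
  have h011 := step _ 0 rfl h111
  have h101 := step _ 1 rfl h111
  have h110 := step _ 2 rfl h111
  rw [(update_triple ..).1] at h011
  rw [(update_triple ..).2.1] at h101
  rw [(update_triple ..).2.2] at h110
  have h001 := step _ 1 rfl h011
  have h010 := step _ 2 rfl h011
  have h100 := step _ 2 rfl h101
  rw [(update_triple ..).2.1] at h001
  rw [(update_triple ..).2.2] at h010 h100
  have h000 := step _ 2 rfl h001
  rw [(update_triple ..).2.2] at h000
  revert s
  rw [forall_triple]
  exact ⟨h000, h111, h100, h010, h001, h011, h101, h110⟩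

theorem lie_e_vec (i : Fin 3) (s : Fin 3 → Fin 2) :
    ⁅C.e i, C.vec s⁆ = if s i = 0 then 0 else C.vec (Function.update s i 0) := by
  split_ifs with h
  · obtain ⟨c, -, hs⟩ := C.exists_vec_eq s
    have hd : ∀ (s : Fin 3 → Fin 2) (i : Fin 3), s i = 0 →
        (simple (leg i)).1 + (cubeRoot s).1 ≠ 0 ∧ pairing ((simple (leg i)).1 + (cubeRoot s).1)
          ((simple (leg i)).1 + (cubeRoot s).1) ≠ 2 := by decide
    rw [hs, lie_smul, e, C.lie_x_x_of_ne (hd s i h).1 (hd s i h).2, smul_zero]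
  · exact C.lie_e_vec_of_eq_one (by omega)

theorem lie_coroot_vec (β : Fin 4 → ℤ) (s : Fin 3 → Fin 2) :
    ⁅C.coroot β, C.vec s⁆ = pairing (cubeRoot s).1 β • C.vec s := by
  obtain ⟨c, -, hs⟩ := C.exists_vec_eq s
  rw [hs, lie_smul, C.lie_coroot_x, smul_comm]

theorem lie_x_neg' (β : Root) : ⁅C.x β, C.x (-β)⁆ = C.coroot β.1 := C.lie_x_neg β

theorem lie_f_vec (i : Fin 3) (s : Fin 3 → Fin 2) :
    ⁅C.f i, C.vec s⁆ = if s i = 0 then C.vec (Function.update s i 1) else 0 := by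
  have hzero : ∀ t : Fin 3 → Fin 2, t i ≠ 0 → ⁅C.f i, C.vec t⁆ = 0 := by
    intro t h
    obtain ⟨c, -, hs⟩ := C.exists_vec_eq t
    have hd : ∀ (t : Fin 3 → Fin 2) (i : Fin 3), t i ≠ 0 →
        (-simple (leg i)).1 + (cubeRoot t).1 ≠ 0 ∧ pairing ((-simple (leg i)).1 + (cubeRoot t).1)
          ((-simple (leg i)).1 + (cubeRoot t).1) ≠ 2 := by decide
    rw [hs, lie_smul, f, C.lie_x_x_of_ne (hd t i h).1 (hd t i h).2, smul_zero]
  split_ifs with h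
  · have h1 : (Function.update s i 1) i = 1 := by simp
    have hs : C.vec s = ⁅C.e i, C.vec (Function.update s i 1)⁆ := by
      rw [C.lie_e_vec_of_eq_one h1, Function.update_idem, ← h, Function.update_eq_self]
    have hp : ∀ (s : Fin 3 → Fin 2) (i : Fin 3),
        pairing (cubeRoot (Function.update s i 1)).1 (simple (leg i)).1 = -1 := by decide
    rw [hs, leibniz_lie, hzero _ (by simp), lie_zero, add_zero, ← lie_skew (C.f i) (C.e i), e, f,
      lie_x_neg', neg_lie, C.lie_coroot_vec, hp, neg_smul, one_smul, neg_neg]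
  · exact hzero s h

theorem lie_e_x_neg_rho (i : Fin 3) : ⁅C.e i, C.x (-rho)⁆ = 0 := by
  refine C.lie_x_x_of_ne ?_ ?_ <;> (revert i; decide)

theorem lie_f_x_neg_rho (i : Fin 3) : ⁅C.f i, C.x (-rho)⁆ = 0 := by
  refine C.lie_x_x_of_ne ?_ ?_ <;> (revert i; decide)

theorem lie_e_x_rho (i : Fin 3) : ⁅C.e i, C.x rho⁆ = 0 := by
  refine C.lie_x_x_of_ne ?_ ?_ <;> (revert i; decide)

/-- The sign with which `vec s` and `vec (1 - s)` pair. -/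
def sign {F : Type*} [Field F] (s : Fin 3 → Fin 2) : F := ∏ i, if s i = 0 then -1 else 1

/-- The structure constant of the symplectic form on `𝔤₁`; it is `1` or `-1`. -/
noncomputable def kappa : F := C.basis.repr ⁅C.vec ![1, 1, 1], C.vec ![0, 0, 0]⁆ (.inr rho)

theorem repr_x_rho : C.basis.repr (C.x rho) (.inr rho) = 1 := by
  rw [x, Module.Basis.repr_self, Finsupp.single_eq_same]

theorem kappa_spec : C.kappa * C.kappa = 1 ∧
    ⁅C.vec ![1, 1, 1], C.vec ![0, 0, 0]⁆ = C.kappa • C.x rho := by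
  obtain ⟨c, hc, h1⟩ := C.exists_vec_eq ![1, 1, 1]
  obtain ⟨d, hd, h2⟩ := C.exists_vec_eq ![0, 0, 0]
  obtain ⟨m, hm, h3⟩ := C.lie_x_x_of_eq (β := cubeRoot ![1, 1, 1]) (γ := cubeRoot ![0, 0, 0])
    (δ := rho) (by decide)
  have h : ⁅C.vec ![1, 1, 1], C.vec ![0, 0, 0]⁆ = (c * d * m) • C.x rho := by
    rw [h1, h2, lie_smul, smul_lie, h3, smul_smul, smul_smul]
    congr 1
    ring
  have hk : C.kappa = c * d * m := by
    rw [kappa, h, map_smul, Finsupp.smul_apply, repr_x_rho, smul_eq_mul, mul_one]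
  refine ⟨?_, by rw [hk, h]⟩
  rw [hk]
  linear_combination d * d * m * m * hc + m * m * hd + hm

theorem lie_vec_vec_of_ne {s t : Fin 3 → Fin 2} (h : t ≠ 1 - s) : ⁅C.vec s, C.vec t⁆ = 0 := by
  obtain ⟨c, -, hs⟩ := C.exists_vec_eq s
  obtain ⟨d, -, ht⟩ := C.exists_vec_eq t
  have hd : ∀ s t : Fin 3 → Fin 2, t ≠ 1 - s → (cubeRoot s).1 + (cubeRoot t).1 ≠ 0 ∧
      pairing ((cubeRoot s).1 + (cubeRoot t).1) ((cubeRoot s).1 + (cubeRoot t).1) ≠ 2 := by decide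
  rw [hs, ht, lie_smul, smul_lie, C.lie_x_x_of_ne (hd s t h).1 (hd s t h).2, smul_zero, smul_zero]

theorem lie_vec_vec_update {s : Fin 3 → Fin 2} {i : Fin 3} (h : s i = 1) :
    ⁅C.vec (Function.update s i 0), C.vec (1 - Function.update s i 0)⁆ =
      -⁅C.vec s, C.vec (1 - s)⁆ := by
  have hne : ∀ (s : Fin 3 → Fin 2) (i : Fin 3), s i = 1 → 1 - Function.update s i 0 ≠ 1 - s ∧
      (1 - Function.update s i 0) i ≠ 0 ∧
      Function.update (1 - Function.update s i 0) i 0 = 1 - s := by decide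
  obtain ⟨h1, h2, h3⟩ := hne s i h
  have h0 := leibniz_lie (C.e i) (C.vec s) (C.vec (1 - Function.update s i 0))
  rw [C.lie_vec_vec_of_ne h1, lie_zero, C.lie_e_vec_of_eq_one h, C.lie_e_vec, if_neg h2, h3] at h0
  exact eq_neg_of_add_eq_zero_left h0.symm

theorem lie_vec_vec_compl (s : Fin 3 → Fin 2) :
    ⁅C.vec s, C.vec (1 - s)⁆ = (C.kappa * sign s) • C.x rho := by
  have step : ∀ (s : Fin 3 → Fin 2) (i : Fin 3), s i = 1 →
      ⁅C.vec s, C.vec (1 - s)⁆ = (C.kappa * sign s) • C.x rho →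
      ⁅C.vec (Function.update s i 0), C.vec (1 - Function.update s i 0)⁆ =
        (C.kappa * sign (Function.update s i 0)) • C.x rho := by
    intro s i h hs
    have hsign : sign (F := F) (Function.update s i 0) = -sign s := by
      unfold sign
      rw [← Finset.mul_prod_erase _ _ (Finset.mem_univ i),
        ← Finset.mul_prod_erase _ _ (Finset.mem_univ i)]
      rw [Finset.prod_congr rfl fun j hj => by
        rw [Function.update_of_ne (Finset.ne_of_mem_erase hj)]]
      simp [h]
    rw [C.lie_vec_vec_update h, hs, hsign, mul_neg, neg_smul]
  have h111 : ⁅C.vec ![1, 1, 1], C.vec (1 - ![1, 1, 1])⁆ =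
      (C.kappa * sign ![1, 1, 1]) • C.x rho := by
    rw [show (1 - ![1, 1, 1] : Fin 3 → Fin 2) = ![0, 0, 0] by decide, C.kappa_spec.2]
    simp [sign, Fin.prod_univ_three]
  have h011 := step _ 0 rfl h111
  have h101 := step _ 1 rfl h111
  have h110 := step _ 2 rfl h111
  rw [(update_triple ..).1] at h011
  rw [(update_triple ..).2.1] at h101
  rw [(update_triple ..).2.2] at h110
  have h001 := step _ 1 rfl h011
  have h010 := step _ 2 rfl h011
  have h100 := step _ 2 rfl h101
  rw [(update_triple ..).2.1] at h001
  rw [(update_triple ..).2.2] at h010 h100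
  have h000 := step _ 2 rfl h001
  rw [(update_triple ..).2.2] at h000
  revert s
  rw [forall_triple]
  exact ⟨h000, h111, h100, h010, h001, h011, h101, h110⟩

/-- The basis vector `[vec s, x_{-ρ}]` of the grade `-1` part. -/
noncomputable def covec (s : Fin 3 → Fin 2) : L := ⁅C.vec s, C.x (-rho)⁆

theorem exists_covec_eq (s : Fin 3 → Fin 2) :
    ∃ c : F, c * c = 1 ∧ C.covec s = c • C.x (-cubeRoot (1 - s)) := by
  obtain ⟨c, hc, hs⟩ := C.exists_vec_eq s
  have hroot : ∀ s : Fin 3 → Fin 2, (cubeRoot s).1 + (-rho).1 = (-cubeRoot (1 - s)).1 := by decide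
  obtain ⟨d, hd, hd'⟩ := C.lie_x_x_of_eq (hroot s)
  refine ⟨c * d, by linear_combination d * d * hc + hd, ?_⟩
  rw [covec, hs, smul_lie, hd', smul_smul]

theorem lie_e_covec (i : Fin 3) (s : Fin 3 → Fin 2) :
    ⁅C.e i, C.covec s⁆ = if s i = 0 then 0 else C.covec (Function.update s i 0) := by
  rw [covec, leibniz_lie, C.lie_e_x_neg_rho, lie_zero, add_zero, C.lie_e_vec]
  split_ifs
  · exact zero_lie _
  · rfl

theorem lie_f_covec (i : Fin 3) (s : Fin 3 → Fin 2) :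
    ⁅C.f i, C.covec s⁆ = if s i = 0 then C.covec (Function.update s i 1) else 0 := by
  rw [covec, leibniz_lie, C.lie_f_x_neg_rho, lie_zero, add_zero, C.lie_f_vec]
  split_ifs
  · rfl
  · exact zero_lie _

theorem repr_coroot (β : Fin 4 → ℤ) (j : Fin 4) :
    C.basis.repr (C.coroot β) (.inl j) = (β j : F) := by
  classical
  simp [coroot, Finsupp.single_apply]

theorem lie_vec_covec_compl (s : Fin 3 → Fin 2) :
    ⁅C.vec s, C.covec (1 - s)⁆ = (C.kappa * sign s) • C.coroot (cubeRoot s).1 := by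
  have key : ∀ s, ∃ c : F, ⁅C.vec s, C.covec (1 - s)⁆ = c • C.coroot (cubeRoot s).1 := by
    intro s
    obtain ⟨c, hc, h1⟩ := C.exists_vec_eq s
    obtain ⟨d, hd, h2⟩ := C.exists_covec_eq (1 - s)
    refine ⟨c * d, ?_⟩
    rw [h1, h2, sub_sub_cancel, lie_smul, smul_lie, lie_x_neg', smul_smul, mul_comm]
  obtain ⟨c, hc⟩ := key s
  obtain ⟨d, hd⟩ := key (1 - s)
  rw [sub_sub_cancel] at hd
  -- the Jacobi identity for `vec s`, `vec (1 - s)` and `x_{-ρ}` is a relation between coroots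
  have hJ := leibniz_lie (C.vec s) (C.vec (1 - s)) (C.x (-rho))
  rw [C.lie_vec_vec_compl, smul_lie, lie_x_neg'] at hJ
  change ⁅C.vec s, C.covec (1 - s)⁆ = _ + ⁅C.vec (1 - s), C.covec s⁆ at hJ
  rw [hc, hd] at hJ
  have h0 := congrArg (fun z => C.basis.repr z (.inl 0)) hJ
  have h1 := congrArg (fun z => C.basis.repr z (.inl 1)) hJ
  simp only [map_add, map_smul, Finsupp.add_apply, Finsupp.smul_apply, repr_coroot,
    smul_eq_mul] at h0 h1
  rw [hc]
  congr 1
  have hs : s 0 = 0 ∨ s 0 = 1 := by omega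
  rcases hs with hs | hs <;> simp [cubeRoot, rho, hs] at h0 h1
  · exact h0
  · linear_combination h1 - h0

/-- `e i` or `f i`, as `a` is `0` or `1`. -/
noncomputable def outer (i : Fin 3) (a : Fin 2) : L := if a = 0 then C.e i else C.f i

theorem lie_outer_coroot (i : Fin 3) (s : Fin 3 → Fin 2) :
    ⁅C.outer i (s i), C.coroot (cubeRoot s).1⁆ = -C.outer i (s i) := by
  have h0 : ∀ (s : Fin 3 → Fin 2) (i : Fin 3), s i = 0 →
      pairing (simple (leg i)).1 (cubeRoot s).1 = 1 := by decide
  have h1 : ∀ (s : Fin 3 → Fin 2) (i : Fin 3), ¬ s i = 0 →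
      pairing (-simple (leg i)).1 (cubeRoot s).1 = 1 := by decide
  unfold outer
  split_ifs with h
  · rw [← lie_skew, e, C.lie_coroot_x, h0 s i h, one_smul]
  · rw [← lie_skew, f, C.lie_coroot_x, h1 s i h, one_smul]

theorem lie_outer_vec (i : Fin 3) (s : Fin 3 → Fin 2) : ⁅C.outer i (s i), C.vec s⁆ = 0 := by
  unfold outer
  split_ifs with h
  · rw [C.lie_e_vec, if_pos h]
  · rw [C.lie_f_vec, if_neg h]

theorem lie_outer_covec (i : Fin 3) (s : Fin 3 → Fin 2) :
    ⁅C.outer i (s i), C.covec (1 - s)⁆ = C.covec (Function.update (1 - s) i (s i)) := by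
  unfold outer
  split_ifs with h
  · have h1 : (1 - s) i = 1 := by simp [h]
    rw [C.lie_e_covec, if_neg (by simp [h1]), h]
  · have h1 : s i = 1 := by omega
    rw [C.lie_f_covec, if_pos (by simp [h1]), h1]

theorem lie_vec_covec_update (s : Fin 3 → Fin 2) (i : Fin 3) :
    ⁅C.vec s, C.covec (Function.update (1 - s) i (s i))⁆ =
      -((C.kappa * sign s) • C.outer i (s i)) := by
  have h := leibniz_lie (C.outer i (s i)) (C.vec s) (C.covec (1 - s))
  rw [C.lie_vec_covec_compl, lie_smul, C.lie_outer_coroot, C.lie_outer_vec, zero_lie, zero_add,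
    C.lie_outer_covec, smul_neg] at h
  exact h.symm

theorem lie_vec_covec_of_ne {s t : Fin 3 → Fin 2} (h : t ≠ 1 - s)
    (h' : ∀ i, t ≠ Function.update (1 - s) i (s i)) : ⁅C.vec s, C.covec t⁆ = 0 := by
  have hd : ∀ s t : Fin 3 → Fin 2, t ≠ 1 - s → (∀ i, t ≠ Function.update (1 - s) i (s i)) →
      (cubeRoot s).1 + (-cubeRoot (1 - t)).1 ≠ 0 ∧
      pairing ((cubeRoot s).1 + (-cubeRoot (1 - t)).1)
        ((cubeRoot s).1 + (-cubeRoot (1 - t)).1) ≠ 2 := by decide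
  obtain ⟨c, -, hs⟩ := C.exists_vec_eq s
  obtain ⟨d, -, ht⟩ := C.exists_covec_eq t
  rw [hs, ht, lie_smul, smul_lie, C.lie_x_x_of_ne (hd s t h h').1 (hd s t h h').2, smul_zero,
    smul_zero]

theorem lie_vec_covec (s t : Fin 3 → Fin 2) : ⁅C.vec s, C.covec t⁆ = (C.kappa * sign s) •
    ((if t = 1 - s then C.coroot (cubeRoot s).1 else 0) -
      ∑ i, if t = Function.update (1 - s) i (s i) then C.outer i (s i) else 0) := by
  have hne : ∀ (s : Fin 3 → Fin 2) (i : Fin 3), 1 - s ≠ Function.update (1 - s) i (s i) := by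
    decide
  have hinj : ∀ (s : Fin 3 → Fin 2) (i j : Fin 3),
      Function.update (1 - s) i (s i) = Function.update (1 - s) j (s j) ↔ i = j := by decide
  by_cases h : t = 1 - s
  · subst h
    simp [hne, C.lie_vec_covec_compl]
  · by_cases h' : ∃ i, t = Function.update (1 - s) i (s i)
    · obtain ⟨i, rfl⟩ := h'
      simp [(hne s i).symm, hinj, C.lie_vec_covec_update]
    · push Not at h'
      simp [h, h', C.lie_vec_covec_of_ne h h']

/-! ### The quartic form is six times the hyperdeterminant -/

/-- The linear map from cubes to `𝔤` that sends the basis tensors to the vectors `vec s`. -/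
noncomputable def ofCube : Cube F →ₗ[F] L := Fintype.linearCombination F C.vec

theorem ofCube_apply (a : Cube F) : C.ofCube a = ∑ s, a s • C.vec s := rfl

theorem lie_ofCube_ofCube (a b : Cube F) : ⁅C.ofCube a, C.ofCube b⁆ =
    (C.kappa * ∑ s, sign s * a s * b (1 - s)) • C.x rho := by
  have h : ∀ s, ⁅C.vec s, C.ofCube b⁆ = (b (1 - s) * (C.kappa * sign s)) • C.x rho := fun s => by
    rw [ofCube_apply, lie_sum, Finset.sum_eq_single (1 - s), lie_smul, C.lie_vec_vec_compl,
      smul_smul]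
    · exact fun t _ ht => by rw [lie_smul, C.lie_vec_vec_of_ne ht, smul_zero]
    · simp
  rw [ofCube_apply, sum_lie, Finset.mul_sum, Finset.sum_smul]
  refine Finset.sum_congr rfl fun s _ => ?_
  rw [smul_lie, h, smul_smul]
  congr 1
  ring

theorem lie_e_ofCube (i : Fin 3) (a : Cube F) : ⁅C.e i, C.ofCube a⁆ =
    C.ofCube fun s => if s i = 0 then a (Function.update s i 1) else 0 := by
  simp only [ofCube_apply, lie_sum, lie_smul, lie_e_vec]
  simp only [sum_triple]
  fin_cases i <;> simp [update_triple] <;> abel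

theorem lie_f_ofCube (i : Fin 3) (a : Cube F) : ⁅C.f i, C.ofCube a⁆ =
    C.ofCube fun s => if s i = 0 then 0 else a (Function.update s i 0) := by
  simp only [ofCube_apply, lie_sum, lie_smul, lie_f_vec]
  simp only [sum_triple]
  fin_cases i <;> simp [update_triple] <;> abel

theorem lie_coroot_ofCube (β : Fin 4 → ℤ) (a : Cube F) : ⁅C.coroot β, C.ofCube a⁆ =
    C.ofCube fun s => (pairing (cubeRoot s).1 β : F) * a s := by
  simp only [ofCube_apply, lie_sum, lie_smul, lie_coroot_vec]
  refine Finset.sum_congr rfl fun s _ => ?_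
  rw [mul_smul, Int.cast_smul_eq_zsmul, smul_comm]

theorem lie_ofCube_lie_ofCube_x_neg_rho (a : Cube F) :
    ⁅C.ofCube a, ⁅C.ofCube a, C.x (-rho)⁆⁆ = ∑ s, (C.kappa * sign s * a s) •
      (a (1 - s) • C.coroot (cubeRoot s).1 -
        ∑ i, a (Function.update (1 - s) i (s i)) • C.outer i (s i)) := by
  have h : ⁅C.ofCube a, C.x (-rho)⁆ = ∑ s, a s • C.covec s := by
    simp only [ofCube_apply, sum_lie, smul_lie, covec]
  rw [h, ofCube_apply, sum_lie]
  refine Finset.sum_congr rfl fun s _ => ?_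
  simp only [smul_lie, lie_sum, lie_smul, lie_vec_covec]
  have hk : ∀ (c : F) (D : (Fin 3 → Fin 2) → L),
      ∑ t, a t • c • D t = c • ∑ t, a t • D t := fun c D => by
    rw [Finset.smul_sum]
    exact Finset.sum_congr rfl fun t _ => smul_comm _ _ _
  rw [hk, hk, smul_smul, mul_comm (a s)]
  congr 1
  simp only [smul_sub, Finset.sum_sub_distrib, smul_ite, smul_zero, Finset.smul_sum]
  congr 1
  · simp
  rw [Finset.sum_comm]
  simp

/-- `[y, [outer i b, y]]` for the element `y` of `𝔤₁` that corresponds to `a`. -/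
theorem quadratic_outer (i : Fin 3) (b : Fin 2) (a : Cube F) :
    ⁅C.ofCube a, ⁅C.outer i b, C.ofCube a⁆⁆ = (C.kappa * ∑ s, sign s * a s *
      if (1 - s) i = b then a (Function.update (1 - s) i (1 - b)) else 0) • C.x rho := by
  have hb : b = 0 ∨ b = 1 := by omega
  rcases hb with rfl | rfl
  · rw [outer, if_pos rfl, C.lie_e_ofCube, C.lie_ofCube_ofCube]
    rfl
  · rw [outer, if_neg (by decide), C.lie_f_ofCube, C.lie_ofCube_ofCube]
    congr 3
    ext s
    have : (1 - s) i = 0 ∨ (1 - s) i = 1 := by omega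
    rcases this with h | h <;> simp only [h] <;> simp

theorem quadratic_coroot (t : Fin 3 → Fin 2) (a : Cube F) :
    ⁅C.ofCube a, ⁅C.coroot (cubeRoot t).1, C.ofCube a⁆⁆ = (C.kappa * ∑ s, sign s * a s *
      ((pairing (cubeRoot (1 - s)).1 (cubeRoot t).1 : F) * a (1 - s))) • C.x rho := by
  rw [C.lie_coroot_ofCube, C.lie_ofCube_ofCube]

/-- The element `(ad y)² x_{-ρ}` of `𝔤₀` is a combination of coroots of roots of height one and of
root vectors of outer nodes; two further brackets with `y` turn each of these into a value of a quadratic form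
times `x_ρ`. -/
theorem quartic_ofCube (a : Cube F) :
    ⁅C.ofCube a, ⁅C.ofCube a, ⁅C.ofCube a, ⁅C.ofCube a, C.x (-rho)⁆⁆⁆⁆ =
      (6 * hdet a) • C.x rho := by
  rw [lie_ofCube_lie_ofCube_x_neg_rho, ← lie_skew (C.ofCube a) (∑ _, _)]
  have hk := C.kappa_spec.1
  simp only [sum_lie, smul_lie, sub_lie, lie_neg, lie_sum, lie_smul, lie_sub, quadratic_outer,
    quadratic_coroot, smul_smul, ← Finset.sum_smul, ← sub_smul, ← neg_smul]
  congr 1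
  have hsub : ∀ a b c : Fin 2, 1 - ![a, b, c] = ![1 - a, 1 - b, 1 - c] := by decide
  simp only [sum_triple, Fin.sum_univ_three, pairing_cubeRoot, hsub, update_triple, sign,
    Fin.prod_univ_three, Matrix.cons_val_zero, Matrix.cons_val_one, Matrix.cons_val, hdet_eq]
  simp only [sub_zero, sub_self, one_ne_zero, if_true, if_false, zero_ne_one, Fin.isValue]
  norm_num
  linear_combination (6 * hdet a) * hk - 6 * (C.kappa * C.kappa - 1) * hdet_eq a

theorem linearIndependent_vec : LinearIndependent F C.vec := by
  choose c hc hv using C.exists_vec_eq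
  have hunit : ∀ s, IsUnit (c s) := fun s => IsUnit.of_mul_eq_one _ (hc s)
  have h := (C.basis.linearIndependent.comp (fun s => Sum.inr (cubeRoot s))
    (Sum.inr_injective.comp cubeRoot_injective)).units_smul fun s => (hunit s).unit
  convert h using 1
  funext s
  exact hv s

theorem ofCube_injective : Function.Injective C.ofCube :=
  C.linearIndependent_vec.fintypeLinearCombination_injective

theorem ofCube_mem (a : Cube F) : C.ofCube a ∈ C.g1 := by
  rw [ofCube_apply]
  refine Submodule.sum_mem _ fun s _ => Submodule.smul_mem _ _ ?_
  obtain ⟨c, -, hs⟩ := C.exists_vec_eq s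
  rw [hs]
  exact Submodule.smul_mem _ _ (Submodule.subset_span ⟨cubeRoot s, height_cubeRoot s, rfl⟩)

theorem g1_le_range_ofCube : C.g1 ≤ LinearMap.range C.ofCube := by
  refine Submodule.span_le.mpr ?_
  rintro _ ⟨β, hβ, rfl⟩
  obtain ⟨s, rfl⟩ := exists_cubeRoot_eq hβ
  obtain ⟨c, hc, hs⟩ := C.exists_vec_eq s
  refine ⟨Pi.single s c, ?_⟩
  rw [ofCube, Fintype.linearCombination_apply_single, hs, smul_smul, hc, one_smul]

/-- The identification of the space of cubes with `𝔤₁`. -/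
noncomputable def cubeEquiv : Cube F ≃ₗ[F] C.g1 :=
  LinearEquiv.ofBijective (C.ofCube.codRestrict C.g1 C.ofCube_mem)
    ⟨fun _ _ h => C.ofCube_injective (congrArg Subtype.val h), fun y => by
      obtain ⟨a, ha⟩ := C.g1_le_range_ofCube y.2
      exact ⟨a, Subtype.ext ha⟩⟩

theorem coe_cubeEquiv (a : Cube F) : (C.cubeEquiv a : L) = C.ofCube a := rfl

theorem q_cubeEquiv (a : Cube F) : C.q (C.cubeEquiv a) = 6 * hdet a := by
  rw [q, coe_cubeEquiv, quartic_ofCube, map_smul, Finsupp.smul_apply, repr_x_rho, smul_eq_mul,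
    mul_one]

/-- The identification of `𝔤₁` with the space of cubes, in the coordinates of `cubeDisc`. -/
noncomputable def cubeCoordinates : C.g1 ≃ₗ[F] (Fin 2 → Fin 2 → Fin 2 → F) :=
  C.cubeEquiv.symm.trans
    { toFun y i j k := y ![i, j, k]
      invFun A s := A (s 0) (s 1) (s 2)
      map_add' _ _ := rfl
      map_smul' _ _ := rfl
      left_inv y := by
        refine funext fun s => congrArg y (funext fun i => ?_)
        fin_cases i <;> rfl
      right_inv _ := rfl }

theorem q_eq_cubeDisc (y : C.g1) : C.q y = 6 * cubeDisc (C.cubeCoordinates y) := by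
  obtain ⟨a, rfl⟩ := C.cubeEquiv.surjective y
  rw [q_cubeEquiv, cubeCoordinates, LinearEquiv.trans_apply, LinearEquiv.symm_apply_apply]
  rfl

theorem finrank_g1 : Module.finrank F C.g1 = 8 := by
  rw [← C.cubeEquiv.finrank_eq]
  simp

end ChevalleyBasis

/-! ### Diagram automorphisms -/

/-- The permutation of the nodes of the Dynkin diagram that permutes the outer nodes by `σ`. -/
def nodePerm (σ : Equiv.Perm (Fin 3)) : Equiv.Perm (Fin 4) where
  toFun := ![leg (σ 0), 1, leg (σ 1), leg (σ 2)]
  invFun := ![leg (σ.symm 0), 1, leg (σ.symm 1), leg (σ.symm 2)]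
  left_inv := by revert σ; decide
  right_inv := by revert σ; decide

theorem nodePerm_leg (σ : Equiv.Perm (Fin 3)) (i : Fin 3) : nodePerm σ (leg i) = leg (σ i) := by
  fin_cases i <;> rfl

theorem pairing_comp_nodePerm (σ : Equiv.Perm (Fin 3)) (β γ : Fin 4 → ℤ) :
    pairing (β ∘ (nodePerm σ).symm) (γ ∘ (nodePerm σ).symm) = pairing β γ := by
  have h0 : (nodePerm σ).symm 0 = leg (σ.symm 0) := rfl
  have h1 : (nodePerm σ).symm 1 = 1 := rfl
  have h2 : (nodePerm σ).symm 2 = leg (σ.symm 1) := rfl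
  have h3 : (nodePerm σ).symm 3 = leg (σ.symm 2) := rfl
  have h01 : σ.symm 0 ≠ σ.symm 1 := by simp
  have h02 : σ.symm 0 ≠ σ.symm 2 := by simp
  have h12 : σ.symm 1 ≠ σ.symm 2 := by simp
  simp only [pairing_eq, Function.comp_apply, h0, h1, h2, h3]
  generalize σ.symm 0 = a at *
  generalize σ.symm 1 = b at *
  generalize σ.symm 2 = c at *
  clear h0 h1 h2 h3
  fin_cases a <;> fin_cases b <;> fin_cases c <;>
    first | contradiction | (simp [leg]; done) | (simp [leg]; ring)

/-- The action of a diagram automorphism on the roots. -/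
def rootPerm (σ : Equiv.Perm (Fin 3)) : Root ≃ Root where
  toFun β := ⟨β.1 ∘ (nodePerm σ).symm, by rw [pairing_comp_nodePerm]; exact β.2⟩
  invFun β := ⟨β.1 ∘ nodePerm σ, by
    rw [← pairing_comp_nodePerm σ]
    have h : ∀ β : Fin 4 → ℤ, (β ∘ nodePerm σ) ∘ (nodePerm σ).symm = β := fun β => by
      ext; simp
    rw [h]
    exact β.2⟩
  left_inv β := Subtype.ext (by ext; simp)
  right_inv β := Subtype.ext (by ext; simp)

theorem rootPerm_neg (σ : Equiv.Perm (Fin 3)) (β : Root) : rootPerm σ (-β) = -rootPerm σ β := rfl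

theorem rootPerm_simple (σ : Equiv.Perm (Fin 3)) (j : Fin 4) :
    rootPerm σ (simple j) = simple (nodePerm σ j) := by
  have h : ∀ (σ : Equiv.Perm (Fin 3)) (j : Fin 4),
      (simple j).1 ∘ (nodePerm σ).symm = (simple (nodePerm σ j)).1 := by decide
  exact Subtype.ext (h σ j)

theorem rootPerm_rho (σ : Equiv.Perm (Fin 3)) : rootPerm σ rho = rho := by
  have h : ∀ σ : Equiv.Perm (Fin 3), rho.1 ∘ (nodePerm σ).symm = rho.1 := by decide
  exact Subtype.ext (h σ)

theorem rootPerm_cubeRoot (σ : Equiv.Perm (Fin 3)) (s : Fin 3 → Fin 2) :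
    rootPerm σ (cubeRoot s) = cubeRoot (s ∘ σ.symm) := by
  have h : ∀ (σ : Equiv.Perm (Fin 3)) (s : Fin 3 → Fin 2),
      (cubeRoot s).1 ∘ (nodePerm σ).symm = (cubeRoot (s ∘ σ.symm)).1 := by decide
  exact Subtype.ext (h σ s)

/-- The roots, sorted by their height. -/
theorem root_cases (β : Root) : β = rho ∨ β = -rho ∨ (∃ s, β = cubeRoot s) ∨
    (∃ s, β = -cubeRoot s) ∨ (∃ i, β = simple (leg i)) ∨ ∃ i, β = -simple (leg i) := by
  have hneg : ∀ γ : Root, γ = - -γ := fun γ => Subtype.ext (neg_neg γ.1).symm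
  have hβ := β.2
  change pairing β.1 β.1 = 2 at hβ
  have hext : ∀ γ : Root, β.1 0 = γ.1 0 → β.1 1 = γ.1 1 → β.1 2 = γ.1 2 → β.1 3 = γ.1 3 → β = γ :=
    fun γ h0 h1 h2 h3 => Subtype.ext (funext fun i => by fin_cases i <;> assumption)
  have hsq : (2 * β.1 0 - β.1 1) ^ 2 + (2 * β.1 2 - β.1 1) ^ 2 + (2 * β.1 3 - β.1 1) ^ 2 +
      β.1 1 ^ 2 = 4 := by
    rw [pairing_eq] at hβ
    linear_combination 2 * hβ
  have b1 : -2 ≤ β.1 1 := by nlinarith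
  have b2 : β.1 1 ≤ 2 := by nlinarith
  rcases (by omega : β.1 1 = 1 ∨ β.1 1 = -1 ∨ β.1 1 = 2 ∨ β.1 1 = -2 ∨ β.1 1 = 0) with
    h | h | h | h | h
  · obtain ⟨s, hs⟩ := exists_cubeRoot_eq (β := β) h
    exact Or.inr (Or.inr (Or.inl ⟨s, hs.symm⟩))
  · obtain ⟨s, hs⟩ := exists_cubeRoot_eq (β := -β) (by
      change -β.1 1 = 1
      rw [h, neg_neg])
    exact Or.inr (Or.inr (Or.inr (Or.inl ⟨s, by rw [hs, ← hneg]⟩)))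
  · rw [h] at hsq
    refine Or.inl (hext _ ?_ h ?_ ?_) <;> change _ = (1 : ℤ) <;> nlinarith
  · rw [h] at hsq
    refine Or.inr (Or.inl (hext _ ?_ h ?_ ?_)) <;> change _ = (-1 : ℤ) <;> nlinarith
  · rw [h] at hsq
    have c0 : -1 ≤ β.1 0 ∧ β.1 0 ≤ 1 := ⟨by nlinarith, by nlinarith⟩
    have c2 : -1 ≤ β.1 2 ∧ β.1 2 ≤ 1 := ⟨by nlinarith, by nlinarith⟩
    have c3 : -1 ≤ β.1 3 ∧ β.1 3 ≤ 1 := ⟨by nlinarith, by nlinarith⟩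
    have hd : ∀ a ∈ Finset.Icc (-1 : ℤ) 1, ∀ b ∈ Finset.Icc (-1 : ℤ) 1,
        ∀ c ∈ Finset.Icc (-1 : ℤ) 1,
        (2 * a - 0) ^ 2 + (2 * b - 0) ^ 2 + (2 * c - 0) ^ 2 + 0 ^ 2 = 4 →
        (∃ i, ![a, 0, b, c] = (simple (leg i)).1) ∨ ∃ i, ![a, 0, b, c] = (-simple (leg i)).1 := by
      decide
    have hv : β.1 = ![β.1 0, 0, β.1 2, β.1 3] := by
      ext i; fin_cases i <;> first | rfl | exact h
    rcases hd _ (Finset.mem_Icc.mpr c0) _ (Finset.mem_Icc.mpr c2) _ (Finset.mem_Icc.mpr c3) hsq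
      with ⟨i, hi⟩ | ⟨i, hi⟩
    · exact Or.inr (Or.inr (Or.inr (Or.inr (Or.inl ⟨i, Subtype.ext (hv.trans hi)⟩))))
    · exact Or.inr (Or.inr (Or.inr (Or.inr (Or.inr ⟨i, Subtype.ext (hv.trans hi)⟩))))

namespace ChevalleyBasis

variable {F L : Type*} [Field F] [LieRing L] [LieAlgebra F L] (C : ChevalleyBasis F L)

theorem eq_top_of_mem {S : Submodule F L} (hh : ∀ j, C.basis (.inl j) ∈ S) (hR : C.x rho ∈ S)
    (hN : C.x (-rho) ∈ S) (hv : ∀ s, C.vec s ∈ S) (hc : ∀ s, C.covec s ∈ S)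
    (he : ∀ i, C.e i ∈ S) (hf : ∀ i, C.f i ∈ S) : S = ⊤ := by
  rw [eq_top_iff, ← C.basis.span_eq, Submodule.span_le]
  rintro _ ⟨j | β, rfl⟩
  · exact hh j
  · change C.x β ∈ S
    rcases root_cases β with rfl | rfl | ⟨s, rfl⟩ | ⟨s, rfl⟩ | ⟨i, rfl⟩ | ⟨i, rfl⟩
    · exact hR
    · exact hN
    · obtain ⟨c, hc, hs⟩ := C.exists_vec_eq s
      rw [← one_smul F (C.x _), ← hc, mul_smul, ← hs]
      exact S.smul_mem c (hv s)
    · obtain ⟨c, hc', hs⟩ := C.exists_covec_eq (1 - s)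
      rw [sub_sub_cancel] at hs
      rw [← one_smul F (C.x _), ← hc', mul_smul, ← hs]
      exact S.smul_mem c (hc _)
    · exact he i
    · exact hf i

/-- There are signs that turn the root vectors of height `1` and `-1` into the vectors `vec s` and
`covec s`, and leave the others alone. -/
theorem exists_sign (β : Root) : ∃ c : F, c * c = 1 ∧ (∀ s, β = cubeRoot s → C.vec s = c • C.x β) ∧
    (∀ s, β = -cubeRoot (1 - s) → C.covec s = c • C.x β) ∧
    (β.height ≠ 1 → β.height ≠ -1 → c = 1) := by
  by_cases h1 : β.height = 1
  · obtain ⟨s, rfl⟩ := exists_cubeRoot_eq h1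
    obtain ⟨c, hc, hs⟩ := C.exists_vec_eq s
    refine ⟨c, hc, fun t ht => ?_, fun t ht => ?_, fun h => absurd h1 h⟩
    · rw [← cubeRoot_injective ht, hs]
    · exact absurd (show (1 : ℤ) = -1 from congrArg Root.height ht) (by decide)
  by_cases h2 : β.height = -1
  · obtain ⟨s, hs⟩ := exists_cubeRoot_eq (β := -β) (by
      change -β.height = 1
      rw [h2, neg_neg])
    have hβ : β = -cubeRoot (1 - (1 - s)) := by
      rw [sub_sub_cancel, hs]; exact Subtype.ext (neg_neg β.1).symm
    obtain ⟨c, hc, hs'⟩ := C.exists_covec_eq (1 - s)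
    refine ⟨c, hc, fun t ht => ?_, fun t ht => ?_, fun _ h => absurd h2 h⟩
    · exact absurd (by rw [ht]; rfl) h1
    · have : cubeRoot (1 - t) = cubeRoot s := by
        rw [hs, ht]; exact Subtype.ext (neg_neg _).symm
      rw [← sub_sub_cancel 1 t, cubeRoot_injective this, hs', ← hβ]
  · exact ⟨1, one_mul 1, fun t ht => absurd (by rw [ht]; rfl) h1,
      fun t ht => absurd (by rw [ht]; rfl) h2, fun _ _ => rfl⟩

/-- The basis of `𝔤` adapted to `𝔤₁`, whose root vectors of height `±1` are the `vec s` and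
`covec s`. -/
noncomputable def adaptedBasis : Module.Basis (Fin 4 ⊕ Root) F L :=
  C.basis.isUnitSMul (w := Sum.elim 1 fun β => (C.exists_sign β).choose) (by
    rintro (j | β)
    · exact isUnit_one
    · exact IsUnit.of_mul_eq_one _ (C.exists_sign β).choose_spec.1)

theorem adaptedBasis_inl (j : Fin 4) : C.adaptedBasis (.inl j) = C.basis (.inl j) := by
  simp [adaptedBasis, Module.Basis.isUnitSMul_apply]

theorem adaptedBasis_inr (β : Root) :
    C.adaptedBasis (.inr β) = (C.exists_sign β).choose • C.x β := by
  simp [adaptedBasis, Module.Basis.isUnitSMul_apply, x]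

theorem adaptedBasis_of_height {β : Root} (h1 : β.height ≠ 1) (h2 : β.height ≠ -1) :
    C.adaptedBasis (.inr β) = C.x β := by
  rw [adaptedBasis_inr, (C.exists_sign β).choose_spec.2.2.2 h1 h2, one_smul]

theorem adaptedBasis_cubeRoot (s : Fin 3 → Fin 2) :
    C.adaptedBasis (.inr (cubeRoot s)) = C.vec s := by
  rw [adaptedBasis_inr, (C.exists_sign _).choose_spec.2.1 s rfl]

theorem adaptedBasis_neg_cubeRoot (s : Fin 3 → Fin 2) :
    C.adaptedBasis (.inr (-cubeRoot (1 - s))) = C.covec s := by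
  rw [adaptedBasis_inr, (C.exists_sign _).choose_spec.2.2.1 s rfl]

/-- The linear map that permutes the adapted basis as prescribed by an automorphism of the Dynkin
diagram. -/
noncomputable def diagramMap (σ : Equiv.Perm (Fin 3)) : L ≃ₗ[F] L :=
  C.adaptedBasis.equiv C.adaptedBasis (Equiv.sumCongr (nodePerm σ) (rootPerm σ))

section

variable (σ : Equiv.Perm (Fin 3))

theorem diagramMap_h (j : Fin 4) :
    C.diagramMap σ (C.basis (.inl j)) = C.basis (.inl (nodePerm σ j)) := by
  rw [← adaptedBasis_inl, ← adaptedBasis_inl, diagramMap, Module.Basis.equiv_apply]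
  rfl

theorem diagramMap_adaptedBasis (β : Root) : C.diagramMap σ (C.adaptedBasis (.inr β)) =
    C.adaptedBasis (.inr (rootPerm σ β)) := by
  rw [diagramMap, Module.Basis.equiv_apply]
  rfl

theorem diagramMap_x {β : Root} (h1 : β.height ≠ 1) (h2 : β.height ≠ -1) :
    C.diagramMap σ (C.x β) = C.x (rootPerm σ β) := by
  rw [← C.adaptedBasis_of_height h1 h2, diagramMap_adaptedBasis]
  exact C.adaptedBasis_of_height (β := rootPerm σ β) h1 h2

theorem diagramMap_vec (s : Fin 3 → Fin 2) :
    C.diagramMap σ (C.vec s) = C.vec (s ∘ σ.symm) := by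
  rw [← adaptedBasis_cubeRoot, diagramMap_adaptedBasis, rootPerm_cubeRoot, adaptedBasis_cubeRoot]

theorem diagramMap_covec (s : Fin 3 → Fin 2) :
    C.diagramMap σ (C.covec s) = C.covec (s ∘ σ.symm) := by
  rw [← adaptedBasis_neg_cubeRoot, diagramMap_adaptedBasis, rootPerm_neg, rootPerm_cubeRoot,
    ← adaptedBasis_neg_cubeRoot]
  rfl

theorem diagramMap_rho : C.diagramMap σ (C.x rho) = C.x rho := by
  rw [C.diagramMap_x σ (by decide) (by decide), rootPerm_rho]

theorem diagramMap_neg_rho : C.diagramMap σ (C.x (-rho)) = C.x (-rho) := by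
  rw [C.diagramMap_x σ (by decide) (by decide), rootPerm_neg, rootPerm_rho]

theorem diagramMap_e (i : Fin 3) : C.diagramMap σ (C.e i) = C.e (σ i) := by
  rw [e, C.diagramMap_x σ (by revert i; decide) (by revert i; decide), rootPerm_simple,
    nodePerm_leg, e]

theorem diagramMap_f (i : Fin 3) : C.diagramMap σ (C.f i) = C.f (σ i) := by
  rw [f, C.diagramMap_x σ (by revert i; decide) (by revert i; decide), rootPerm_neg,
    rootPerm_simple, nodePerm_leg, f]

theorem basis_inl_eq_coroot (j : Fin 4) : C.basis (.inl j) = C.coroot (simple j).1 := by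
  simp [coroot, simple, Pi.single_apply, ite_smul]

theorem diagramMap_coroot (β : Root) :
    C.diagramMap σ (C.coroot β.1) = C.coroot (rootPerm σ β).1 := by
  simp only [coroot, map_sum, map_zsmul, diagramMap_h]
  rw [← Equiv.sum_comp (nodePerm σ) fun j => (rootPerm σ β).1 j • C.basis (.inl j)]
  refine Finset.sum_congr rfl fun j _ => ?_
  change _ = β.1 ((nodePerm σ).symm (nodePerm σ j)) • _
  rw [Equiv.symm_apply_apply]

theorem lie_f_x_rho (i : Fin 3) : ⁅C.f i, C.x rho⁆ = 0 := by
  refine C.lie_x_x_of_ne ?_ ?_ <;> (revert i; decide)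

theorem lie_f_f (i j : Fin 3) : ⁅C.f i, C.f j⁆ = 0 := by
  refine C.lie_x_x_of_ne ?_ ?_ <;> (revert i j; decide)

theorem lie_e_f (i j : Fin 3) :
    ⁅C.e i, C.f j⁆ = if i = j then C.coroot (simple (leg i)).1 else 0 := by
  split_ifs with h
  · subst h
    exact C.lie_x_neg' _
  · have hd : ∀ i j : Fin 3, i ≠ j → (simple (leg i)).1 + (-simple (leg j)).1 ≠ 0 ∧
        pairing ((simple (leg i)).1 + (-simple (leg j)).1)
          ((simple (leg i)).1 + (-simple (leg j)).1) ≠ 2 := by decide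
    exact C.lie_x_x_of_ne (hd i j h).1 (hd i j h).2

theorem lie_neg_rho_covec (s : Fin 3 → Fin 2) : ⁅C.x (-rho), C.covec s⁆ = 0 := by
  have hd : ∀ s, (-rho).1 + (-cubeRoot (1 - s)).1 ≠ 0 ∧
      pairing ((-rho).1 + (-cubeRoot (1 - s)).1) ((-rho).1 + (-cubeRoot (1 - s)).1) ≠ 2 := by decide
  obtain ⟨c, -, hs⟩ := C.exists_covec_eq s
  rw [hs, lie_smul, C.lie_x_x_of_ne (hd s).1 (hd s).2, smul_zero]

theorem lie_f_e (i j : Fin 3) :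
    ⁅C.f i, C.e j⁆ = if j = i then -C.coroot (simple (leg j)).1 else 0 := by
  rw [← lie_skew, lie_e_f]
  split_ifs
  · rfl
  · exact neg_zero

/-- The vector `x_{α₂}` in the form in which the bracket tables apply to it. -/
theorem x_simple_one : C.x (simple 1) = C.vec ![1, 1, 1] := by
  simp [vec, raise]

theorem lie_vec_rho (s : Fin 3 → Fin 2) : ⁅C.vec s, C.x rho⁆ = 0 := by
  have hd : ∀ s, (cubeRoot s).1 + rho.1 ≠ 0 ∧
      pairing ((cubeRoot s).1 + rho.1) ((cubeRoot s).1 + rho.1) ≠ 2 := by decide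
  obtain ⟨c, -, hs⟩ := C.exists_vec_eq s
  rw [hs, smul_lie, C.lie_x_x_of_ne (hd s).1 (hd s).2, smul_zero]

theorem diagramMap_lie_h {β : Root} (hβ : C.diagramMap σ (C.x β) = C.x (rootPerm σ β))
    (j : Fin 4) : C.diagramMap σ ⁅C.x β, C.basis (.inl j)⁆ =
      ⁅C.diagramMap σ (C.x β), C.diagramMap σ (C.basis (.inl j))⁆ := by
  rw [← lie_skew, ← lie_skew (C.diagramMap σ (C.x β)), C.diagramMap_h, basis_inl_eq_coroot,
    basis_inl_eq_coroot, C.lie_coroot_x, hβ, C.lie_coroot_x, map_neg, map_zsmul, hβ,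
    ← rootPerm_simple]
  congr 2
  exact (pairing_comp_nodePerm σ _ _).symm

/-- To commute with the bracket by `z`, it suffices to do so on the vectors that span `𝔤`. -/
theorem diagramMap_lie_of_mem {z : L}
    (hh : ∀ j, C.diagramMap σ ⁅z, C.basis (.inl j)⁆ =
      ⁅C.diagramMap σ z, C.diagramMap σ (C.basis (.inl j))⁆)
    (hR : C.diagramMap σ ⁅z, C.x rho⁆ = ⁅C.diagramMap σ z, C.x rho⁆)
    (hN : C.diagramMap σ ⁅z, C.x (-rho)⁆ = ⁅C.diagramMap σ z, C.x (-rho)⁆)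
    (hv : ∀ s, C.diagramMap σ ⁅z, C.vec s⁆ = ⁅C.diagramMap σ z, C.vec (s ∘ σ.symm)⁆)
    (hc : ∀ s, C.diagramMap σ ⁅z, C.covec s⁆ = ⁅C.diagramMap σ z, C.covec (s ∘ σ.symm)⁆)
    (he : ∀ i, C.diagramMap σ ⁅z, C.e i⁆ = ⁅C.diagramMap σ z, C.e (σ i)⁆)
    (hf : ∀ i, C.diagramMap σ ⁅z, C.f i⁆ = ⁅C.diagramMap σ z, C.f (σ i)⁆) (y : L) :
    C.diagramMap σ ⁅z, y⁆ = ⁅C.diagramMap σ z, C.diagramMap σ y⁆ := by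
  have h : LinearMap.eqLocus ((C.diagramMap σ : L →ₗ[F] L) ∘ₗ (LieAlgebra.ad F L z : L →ₗ[F] L))
      ((LieAlgebra.ad F L (C.diagramMap σ z) : L →ₗ[F] L) ∘ₗ (C.diagramMap σ : L →ₗ[F] L)) = ⊤ := by
    apply C.eq_top_of_mem
    all_goals simp only [LinearMap.mem_eqLocus, LinearMap.comp_apply, LinearEquiv.coe_coe,
      LieAlgebra.ad_apply, diagramMap_rho, diagramMap_neg_rho, diagramMap_vec, diagramMap_covec,
      diagramMap_e, diagramMap_f]
    all_goals assumption
  exact LinearMap.mem_eqLocus.mp (h ▸ Submodule.mem_top : y ∈ LinearMap.eqLocus _ _)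

theorem update_comp_symm (s : Fin 3 → Fin 2) (i : Fin 3) (a : Fin 2) :
    Function.update s i a ∘ σ.symm = Function.update (s ∘ σ.symm) (σ i) a := by
  ext j
  simp [Function.update_apply, Equiv.symm_apply_eq]

theorem diagramMap_lie_e (i : Fin 3) (y : L) :
    C.diagramMap σ ⁅C.e i, y⁆ = ⁅C.diagramMap σ (C.e i), C.diagramMap σ y⁆ := by
  apply C.diagramMap_lie_of_mem
  · refine C.diagramMap_lie_h σ ?_
    rw [← e, diagramMap_e, rootPerm_simple, nodePerm_leg, e]
  all_goals simp only [diagramMap_e, lie_e_x_rho, lie_e_x_neg_rho, lie_e_vec, lie_e_covec, lie_e_e,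
    lie_e_f, map_zero, Function.comp_apply, σ.symm_apply_apply, EmbeddingLike.apply_eq_iff_eq]
  · intro s
    split_ifs
    · exact map_zero _
    · rw [diagramMap_vec, update_comp_symm]
  · intro s
    split_ifs
    · exact map_zero _
    · rw [diagramMap_covec, update_comp_symm]
  · exact fun _ => trivial
  · intro j
    split_ifs
    · rw [diagramMap_coroot, rootPerm_simple, nodePerm_leg]
    · exact map_zero _

theorem diagramMap_lie_f (i : Fin 3) (y : L) :
    C.diagramMap σ ⁅C.f i, y⁆ = ⁅C.diagramMap σ (C.f i), C.diagramMap σ y⁆ := by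
  apply C.diagramMap_lie_of_mem
  · refine C.diagramMap_lie_h σ ?_
    rw [← f, diagramMap_f, rootPerm_neg, rootPerm_simple, nodePerm_leg, f]
  all_goals simp only [diagramMap_f, lie_f_x_rho, lie_f_x_neg_rho, lie_f_vec, lie_f_covec, lie_f_f,
    lie_f_e, map_zero, Function.comp_apply, σ.symm_apply_apply, EmbeddingLike.apply_eq_iff_eq]
  · intro s
    split_ifs
    · rw [diagramMap_vec, update_comp_symm]
    · exact map_zero _
  · intro s
    split_ifs
    · rw [diagramMap_covec, update_comp_symm]
    · exact map_zero _
  · intro j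
    split_ifs
    · rw [map_neg, diagramMap_coroot, rootPerm_simple, nodePerm_leg]
    · exact map_zero _
  · exact fun _ => trivial

theorem diagramMap_lie_neg_rho (y : L) :
    C.diagramMap σ ⁅C.x (-rho), y⁆ = ⁅C.diagramMap σ (C.x (-rho)), C.diagramMap σ y⁆ := by
  apply C.diagramMap_lie_of_mem
  · refine C.diagramMap_lie_h σ ?_
    rw [diagramMap_neg_rho, rootPerm_neg, rootPerm_rho]
  all_goals simp only [diagramMap_neg_rho, lie_self, map_zero, lie_neg_rho_covec]
  · rw [← lie_skew, lie_x_neg', map_neg, diagramMap_coroot, rootPerm_rho]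
  · intro s
    rw [← lie_skew, ← lie_skew (C.x (-rho)), ← covec, ← covec, map_neg, diagramMap_covec]
  · exact fun _ => trivial
  · intro i
    rw [← lie_skew, ← lie_skew (C.x (-rho)), lie_e_x_neg_rho, lie_e_x_neg_rho, neg_zero, map_zero]
  · intro i
    rw [← lie_skew, ← lie_skew (C.x (-rho)), lie_f_x_neg_rho, lie_f_x_neg_rho, neg_zero, map_zero]

theorem one_comp_symm : (![1, 1, 1] : Fin 3 → Fin 2) ∘ σ.symm = ![1, 1, 1] := by
  revert σ; decide

/-- The bracket of `x_{α₂}` with a vector of height `-1`, in terms of `x_{-α₁}`, `x_{-α₃}`,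
`x_{-α₄}` and the coroot of `α₂`. -/
theorem lie_vec_one_covec (s : Fin 3 → Fin 2) : ⁅C.vec ![1, 1, 1], C.covec s⁆ = C.kappa •
    ((if s = 0 then C.basis (.inl 1) else 0) -
      ∑ i, if s = Pi.single i 1 then C.f i else 0) := by
  have hd : (1 : Fin 3 → Fin 2) - ![1, 1, 1] = 0 := by decide
  have hr : (cubeRoot ![1, 1, 1]).1 = (simple 1).1 := by decide
  have ho : ∀ i : Fin 3, (![1, 1, 1] : Fin 3 → Fin 2) i = 1 := by decide
  rw [lie_vec_covec, hd, hr, ← basis_inl_eq_coroot]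
  simp only [ho, sign, outer]
  simp [Pi.single]
  rfl

theorem diagramMap_lie_vec_one (y : L) : C.diagramMap σ ⁅C.vec ![1, 1, 1], y⁆ =
    ⁅C.diagramMap σ (C.vec ![1, 1, 1]), C.diagramMap σ y⁆ := by
  have hz : ∀ s : Fin 3 → Fin 2, s = 1 - ![1, 1, 1] ↔ s ∘ σ.symm = 1 - ![1, 1, 1] := by
    revert σ; decide
  have hz' : ∀ s : Fin 3 → Fin 2, s ∘ σ.symm = 0 ↔ s = 0 := by
    revert σ; decide
  have hi : ∀ (s : Fin 3 → Fin 2) (i : Fin 3),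
      s ∘ σ.symm = Pi.single (σ i) 1 ↔ s = Pi.single i 1 := by
    clear hz hz'; revert σ; decide
  have ho : ∀ i : Fin 3, (![1, 1, 1] : Fin 3 → Fin 2) i = 1 := by decide
  have h1 : C.diagramMap σ (C.vec ![1, 1, 1]) = C.vec ![1, 1, 1] := by
    rw [diagramMap_vec, one_comp_symm]
  apply C.diagramMap_lie_of_mem
  · rw [← x_simple_one]
    refine C.diagramMap_lie_h σ ?_
    rw [x_simple_one, h1, rootPerm_simple]
    exact C.x_simple_one.symm
  all_goals rw [h1]
  · rw [lie_vec_rho, map_zero]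
  · rw [← covec, diagramMap_covec, one_comp_symm]
  · intro s
    by_cases hs : s = 1 - ![1, 1, 1]
    · rw [(hz s).mp hs, hs, lie_vec_vec_compl, map_smul, diagramMap_rho]
    · rw [C.lie_vec_vec_of_ne hs, C.lie_vec_vec_of_ne (mt (hz s).mpr hs), map_zero]
  · intro s
    rw [lie_vec_one_covec, lie_vec_one_covec, map_smul, map_sub, map_sum,
      ← Equiv.sum_comp σ fun i => if s ∘ σ.symm = Pi.single i 1 then C.f i else 0]
    simp only [hz', hi, apply_ite (C.diagramMap σ), map_zero, diagramMap_h, diagramMap_f]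
    rfl
  · intro i
    rw [← lie_skew, ← lie_skew (C.vec _), C.lie_e_vec_of_eq_one (ho i),
      C.lie_e_vec_of_eq_one (ho _), map_neg, diagramMap_vec, update_comp_symm, one_comp_symm]
  · intro i
    rw [← lie_skew, ← lie_skew (C.vec _), lie_f_vec, lie_f_vec, ho, ho]
    simp

/-- The elements `z` whose bracket the map `diagramMap σ` respects form a Lie subalgebra, and this
subalgebra contains generators of `𝔤`. -/
theorem diagramMap_lie (z y : L) :
    C.diagramMap σ ⁅z, y⁆ = ⁅C.diagramMap σ z, C.diagramMap σ y⁆ := by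
  let S : Submodule F L :=
    { carrier := {z | ∀ y, C.diagramMap σ ⁅z, y⁆ = ⁅C.diagramMap σ z, C.diagramMap σ y⁆}
      add_mem' := fun {a b} ha hb y => by
        rw [add_lie, map_add, ha, hb, map_add, add_lie]
      zero_mem' := fun y => by simp
      smul_mem' := fun c a ha y => by
        rw [smul_lie, map_smul, ha, map_smul, smul_lie] }
  have hS : ∀ {a b}, a ∈ S → b ∈ S → ⁅a, b⁆ ∈ S := fun {a b} ha hb y => by
    rw [lie_lie, map_sub, ha, hb, hb, ha, ha, lie_lie]
  have hvec : ∀ s, C.vec s ∈ S := by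
    have hr : ∀ {i a z}, z ∈ S → C.raise i a z ∈ S := fun {i a z} hz => by
      unfold raise
      split_ifs
      · exact hS (C.diagramMap_lie_e σ i) hz
      · exact hz
    intro s
    have h1 : C.x (simple 1) ∈ S := C.x_simple_one ▸ C.diagramMap_lie_vec_one σ
    exact hr (hr (hr h1))
  have hcov : ∀ s, C.covec s ∈ S := fun s => hS (hvec s) (C.diagramMap_lie_neg_rho σ)
  have hk : ∀ {a : L}, C.kappa • a ∈ S → a ∈ S := fun {a} ha => by
    rw [← one_smul F a, ← C.kappa_spec.1, mul_smul]
    exact S.smul_mem _ ha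
  have hleg : ∀ i, C.basis (.inl (leg i)) ∈ S := fun i => by
    rw [basis_inl_eq_coroot, ← lie_x_neg']
    exact hS (C.diagramMap_lie_e σ i) (C.diagramMap_lie_f σ i)
  have htop : S = ⊤ := by
    refine C.eq_top_of_mem (fun j => ?_) (hk ?_) (C.diagramMap_lie_neg_rho σ) hvec hcov
      (C.diagramMap_lie_e σ) (C.diagramMap_lie_f σ)
    · fin_cases j
      · exact hleg 0
      · refine hk ?_
        have h := C.lie_vec_one_covec 0
        have h0 : ∀ i : Fin 3, (0 : Fin 3 → Fin 2) ≠ Pi.single i 1 := by decide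
        simp only [if_true, h0, if_false, Finset.sum_const_zero, sub_zero] at h
        exact h ▸ hS (hvec _) (hcov _)
      · exact hleg 1
      · exact hleg 2
    · rw [← C.kappa_spec.2]
      exact hS (hvec _) (hvec _)
  exact (htop ▸ Submodule.mem_top : z ∈ S) y

/-- The automorphism of `𝔤` that is induced by the automorphism of the Dynkin diagram that permutes
the outer nodes by `σ`. -/
noncomputable def diagramAut : L ≃ₗ⁅F⁆ L :=
  { C.diagramMap σ with map_lie' := C.diagramMap_lie σ _ _ }

theorem diagramAut_apply (y : L) : C.diagramAut σ y = C.diagramMap σ y := rfl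

theorem diagramMap_x_neg_simple_one :
    C.diagramMap σ (C.x (-simple 1)) = C.x (-simple 1) := by
  have hs : -cubeRoot (1 - 0) = -simple 1 := Subtype.ext (by decide)
  obtain ⟨c, hc, h⟩ := C.exists_covec_eq 0
  rw [hs] at h
  have h0 : (0 : Fin 3 → Fin 2) ∘ σ.symm = 0 := rfl
  have h' : C.x (-simple 1) = c • C.covec 0 := by
    rw [h, smul_smul, hc, one_smul]
  rw [h', map_smul, diagramMap_covec, h0]

theorem diagramMap_ofCube (a : Cube F) :
    C.diagramMap σ (C.ofCube a) = C.ofCube (permAction F σ a) := by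
  simp only [ofCube_apply, map_sum, map_smul, diagramMap_vec, permAction_apply]
  rw [← Equiv.sum_comp (σ.arrowCongr (Equiv.refl (Fin 2))) fun s => a (s ∘ σ) • C.vec s]
  refine Finset.sum_congr rfl fun s _ => ?_
  have h : (σ.arrowCongr (Equiv.refl (Fin 2)) s) ∘ σ = s := by
    ext j
    simp
  rw [h]
  rfl

end

end ChevalleyBasis

/-! ### The actions of `SL₂³` and `S₃` on `𝔤₁` -/

namespace ChevalleyBasis

variable {F L : Type*} [Field F] [LieRing L] [LieAlgebra F L] (C : ChevalleyBasis F L)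

/-- Transport of automorphisms along the identification of the space of cubes with `𝔤₁`. -/
noncomputable def cubeConj : (Cube F ≃ₗ[F] Cube F) ≃* (C.g1 ≃ₗ[F] C.g1) where
  toFun g := C.cubeEquiv.symm.trans (g.trans C.cubeEquiv)
  invFun g := C.cubeEquiv.trans (g.trans C.cubeEquiv.symm)
  left_inv g := by ext1 a; simp
  right_inv g := by ext1 a; simp
  map_mul' g h := by ext1 a; simp

theorem cubeConj_cubeEquiv (g : Cube F ≃ₗ[F] Cube F) (a : Cube F) :
    C.cubeConj g (C.cubeEquiv a) = C.cubeEquiv (g a) := by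
  simp [cubeConj]

theorem eq_cubeConj_iff {g : C.g1 ≃ₗ[F] C.g1} {g' : Cube F ≃ₗ[F] Cube F} :
    g = C.cubeConj g' ↔ ∀ a, g (C.cubeEquiv a) = C.cubeEquiv (g' a) := by
  refine ⟨fun h a => by rw [h, cubeConj_cubeEquiv], fun h => LinearEquiv.ext fun y => ?_⟩
  rw [← C.cubeEquiv.apply_symm_apply y, h, cubeConj_cubeEquiv]

/-- The action of `SL₂³` on `𝔤₁`. -/
noncomputable def sl2CubeAction :
    (Fin 3 → Matrix.SpecialLinearGroup (Fin 2) F) →* (C.g1 ≃ₗ[F] C.g1) :=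
  C.cubeConj.toMonoidHom.comp (tensorAction F)

theorem sl2CubeAction_cubeEquiv (A : Fin 3 → Matrix.SpecialLinearGroup (Fin 2) F) (a : Cube F) :
    C.sl2CubeAction A (C.cubeEquiv a) = C.cubeEquiv (tensorAction F A a) :=
  C.cubeConj_cubeEquiv _ a

/-- The action of `S₃` on `𝔤₁` by diagram automorphisms. -/
noncomputable def diagramAction : Equiv.Perm (Fin 3) →* (C.g1 ≃ₗ[F] C.g1) :=
  C.cubeConj.toMonoidHom.comp (permAction F)

theorem diagramAction_cubeEquiv (σ : Equiv.Perm (Fin 3)) (a : Cube F) :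
    C.diagramAction σ (C.cubeEquiv a) = C.cubeEquiv (permAction F σ a) :=
  C.cubeConj_cubeEquiv _ a

theorem isDiagramAction_diagramAction : C.IsDiagramAction C.diagramAction := by
  refine ⟨C.diagramAut, fun σ => ⟨?_, C.diagramMap_x_neg_simple_one σ⟩,
    fun σ i => ⟨C.diagramMap_e σ i, C.diagramMap_f σ i⟩, fun σ y => ?_⟩
  · rw [diagramAut_apply, x_simple_one, diagramMap_vec, one_comp_symm]
  · obtain ⟨a, rfl⟩ := C.cubeEquiv.surjective y
    rw [diagramAction_cubeEquiv, coe_cubeEquiv, coe_cubeEquiv, diagramAut_apply,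
      diagramMap_ofCube]

theorem rootExp_ofCube {β : Root} {a b : Cube F} (h : ⁅C.x β, C.ofCube a⁆ = C.ofCube b)
    (h0 : ⁅C.x β, C.ofCube b⁆ = 0) (t : F) :
    C.rootExp β t (C.ofCube a) = C.ofCube (a + t • b) := by
  simp [rootExp, h, h0]

theorem isSL2CubeAction_sl2CubeAction : C.IsSL2CubeAction C.sl2CubeAction := by
  intro i t y
  obtain ⟨a, rfl⟩ := C.cubeEquiv.surjective y
  rw [sl2CubeAction_cubeEquiv, sl2CubeAction_cubeEquiv, coe_cubeEquiv, coe_cubeEquiv,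
    coe_cubeEquiv]
  constructor
  · rw [C.rootExp_ofCube (C.lie_e_ofCube i a)]
    · congr 1
      ext s
      refine (tensorAction_mulSingle i ⟨!![1, t; 0, 1], by simp⟩ a s).trans ?_
      rcases (by omega : s i = 0 ∨ s i = 1) with h | h
      · rw [← Function.update_eq_self i s]
        simp [h]
      · rw [← Function.update_eq_self i s]
        simp [h]
    · refine (C.lie_e_ofCube i _).trans ?_
      simp only [Function.update_self, one_ne_zero, if_false, ite_self]
      exact map_zero C.ofCube
  · rw [C.rootExp_ofCube (C.lie_f_ofCube i a)]
    · congr 1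
      ext s
      refine (tensorAction_mulSingle i ⟨!![1, 0; t, 1], by simp⟩ a s).trans ?_
      rcases (by omega : s i = 0 ∨ s i = 1) with h | h
      · rw [← Function.update_eq_self i s]
        simp [h]
      · rw [← Function.update_eq_self i s]
        simp [h, add_comm]
    · refine (C.lie_f_ofCube i _).trans ?_
      simp only [Function.update_self, if_true, ite_self]
      exact map_zero C.ofCube

/-! ### The stabilizer of the quartic form -/

theorem mem_stab_iff (h6 : (6 : F) ≠ 0) {g : C.g1 ≃ₗ[F] C.g1} {g' : Cube F ≃ₗ[F] Cube F}
    (hg : ∀ a, g (C.cubeEquiv a) = C.cubeEquiv (g' a)) :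
    g ∈ C.stab ↔ ∀ a, hdet (g' a) = hdet a := by
  refine ⟨fun h a => mul_left_cancel₀ h6 ?_, fun h y => ?_⟩
  · rw [← C.q_cubeEquiv, ← C.q_cubeEquiv, ← hg]
    exact h _
  · obtain ⟨a, rfl⟩ := C.cubeEquiv.surjective y
    rw [hg, q_cubeEquiv, q_cubeEquiv, h]

theorem mem_range_sup_mu4 {g : C.g1 ≃ₗ[F] C.g1} : g ∈ C.sl2CubeAction.range ⊔ C.mu4 ↔
    ∃ (A : Fin 3 → Matrix.SpecialLinearGroup (Fin 2) F) (ζ : F), ζ ^ 4 = 1 ∧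
      ∀ a, g (C.cubeEquiv a) = C.cubeEquiv (ζ • tensorAction F A a) := by
  have hn : C.mu4.Normal := by
    refine ⟨?_⟩
    rintro _ ⟨u, hu, rfl⟩ g
    refine ⟨u, hu, ?_⟩
    rw [eq_mul_inv_iff_mul_eq]
    ext1 y
    exact (map_smul g (u : F) y).symm
  rw [Subgroup.mem_sup_of_normal_right]
  constructor
  · rintro ⟨_, ⟨A, rfl⟩, _, ⟨u, hu, rfl⟩, rfl⟩
    refine ⟨A, u, ?_, fun a => ?_⟩
    · have := (mem_rootsOfUnity 4 u).mp hu
      rw [← Units.val_pow_eq_pow_val, this, Units.val_one]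
    · change C.sl2CubeAction A ((u : F) • C.cubeEquiv a) = _
      rw [map_smul, map_smul, sl2CubeAction_cubeEquiv]
  · rintro ⟨A, ζ, hζ, h⟩
    have hu : IsUnit ζ := IsUnit.of_pow_eq_one hζ (by norm_num)
    obtain ⟨u, rfl⟩ := hu
    refine ⟨_, ⟨A, rfl⟩, _, ⟨u, (mem_rootsOfUnity 4 u).mpr (Units.ext hζ), rfl⟩, ?_⟩
    ext1 y
    obtain ⟨a, rfl⟩ := C.cubeEquiv.surjective y
    change C.sl2CubeAction A ((u : F) • C.cubeEquiv a) = _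
    rw [map_smul, sl2CubeAction_cubeEquiv, h, map_smul]

end ChevalleyBasis

/-- A subgroup `S` that is generated by a subgroup `N` and by the image of `δ`, which normalizes
`N` and meets it trivially, is a semidirect product. -/
theorem exists_semidirectProduct_mulEquiv {G H : Type*} [Group G] [Group H] {N S : Subgroup G}
    {δ : H →* G} (hN : N ≤ S) (hδ : ∀ σ, δ σ ∈ S)
    (hconj : ∀ σ, ∀ n ∈ N, δ σ * n * (δ σ)⁻¹ ∈ N) (htriv : ∀ σ, δ σ ∈ N → σ = 1)
    (hsurj : ∀ g ∈ S, ∃ n ∈ N, ∃ σ, g = n * δ σ) :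
    ∃ (θ : H →* MulAut N) (e : N ⋊[θ] H ≃* S), ∀ n σ, (e ⟨n, σ⟩ : G) = n * δ σ := by
  have hnorm : ∀ σ, δ σ ∈ Subgroup.normalizer (N : Set G) := fun σ => by
    rw [Subgroup.mem_normalizer_iff]
    refine fun n => ⟨hconj σ n, fun h => ?_⟩
    have := hconj σ⁻¹ _ h
    simpa [mul_assoc] using this
  let θ : H →* MulAut N := N.normalizerMonoidHom.comp (δ.codRestrict _ hnorm)
  let f : N ⋊[θ] H →* S := SemidirectProduct.lift (Subgroup.inclusion hN) (δ.codRestrict S hδ) <| by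
    intro σ
    ext n
    rfl
  refine ⟨θ, MulEquiv.ofBijective f ⟨?_, ?_⟩, fun n σ => rfl⟩
  · rw [injective_iff_map_eq_one]
    rintro ⟨n, σ⟩ h
    have h' : (n : G) * δ σ = 1 := congrArg Subtype.val h
    obtain rfl : σ = 1 := htriv σ (by
      rw [← inv_eq_of_mul_eq_one_right h']
      exact N.inv_mem n.2)
    obtain rfl : n = 1 := Subtype.ext (by simpa using h')
    rfl
  · rintro ⟨g, hg⟩
    obtain ⟨n, hn, σ, rfl⟩ := hsurj g hg
    exact ⟨⟨⟨n, hn⟩, σ⟩, rfl⟩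

/-- Permuting the factors permutes the components of an element of `SL₂³`. -/
theorem permAction_tensorAction {K : Type*} [Field K] (σ : Equiv.Perm (Fin 3))
    (A : Fin 3 → Matrix.SpecialLinearGroup (Fin 2) K) (y : Cube K) :
    permAction K σ (tensorAction K A y) =
      tensorAction K (A ∘ σ.symm) (permAction K σ y) := by
  ext s
  rw [permAction_apply, tensorAction_apply, tensorAction_apply,
    ← Equiv.sum_comp (σ.symm.arrowCongr (Equiv.refl (Fin 2)))]
  refine Finset.sum_congr rfl fun t _ => ?_
  congr 1
  rw [← Equiv.prod_comp σ fun i => ((A ∘ σ.symm) i : Matrix (Fin 2) (Fin 2) K) (s i) (t i)]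
  refine Finset.prod_congr rfl fun i _ => ?_
  simp

theorem permAction_permAction_inv {K : Type*} [Field K] (σ : Equiv.Perm (Fin 3)) (y : Cube K) :
    permAction K σ (permAction K σ⁻¹ y) = y := by
  rw [← LinearEquiv.mul_apply, ← map_mul, mul_inv_cancel, map_one]
  rfl

/-- A nontrivial permutation of the factors is not a multiple of an element of `SL₂³`. -/
theorem eq_one_of_permAction_eq {K : Type*} [Field K] {σ : Equiv.Perm (Fin 3)}
    {A : Fin 3 → Matrix.SpecialLinearGroup (Fin 2) K} {ζ : K}
    (h : ∀ y, permAction K σ y = ζ • tensorAction K A y) : σ = 1 := by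
  have hσ : ∀ σ : Equiv.Perm (Fin 3), (∀ s : Fin 3 → Fin 2, s = s ∘ σ.symm) → σ = 1 := by decide
  have hts : ∀ s t : Fin 3 → Fin 2, (if t = s ∘ σ.symm then (1 : K) else 0) =
      ζ * ∏ i, A i (t i) (s i) := fun s t => by
    have := congrFun (h (tensor s)) t
    rw [permAction_tensor, Pi.smul_apply, tensorAction_apply, Finset.sum_eq_single s] at this
    · simpa [tensor, Pi.single_apply] using this
    · intro r _ hr
      simp [hr]
    · simp
  have hdiag : ∀ a, 1 = ζ * ∏ i, A i a a := fun a =>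
    (if_pos (show (fun _ => a) = (fun _ => a) ∘ σ.symm from rfl)).symm.trans (hts _ _)
  -- The diagonal entries of the factors are nonzero, hence so are those of their tensor product.
  have hA : ∀ (i : Fin 3) (a : Fin 2), A i a a ≠ 0 := fun i a ha => by
    have := hdiag a
    rw [Finset.prod_eq_zero (Finset.mem_univ i) ha, mul_zero] at this
    exact one_ne_zero this
  have hζ : ζ ≠ 0 := fun h0 => by
    have := hdiag 0
    rw [h0, zero_mul] at this
    exact one_ne_zero this
  refine hσ σ fun s => by_contra fun hs => ?_
  have := hts s s
  rw [if_neg hs] at this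
  exact mul_ne_zero hζ (Finset.prod_ne_zero_iff.mpr fun i _ => hA i (s i)) this.symm

namespace ChevalleyBasis

variable {K L : Type*} [Field K] [LieRing L] [LieAlgebra K L] (C : ChevalleyBasis K L)

theorem range_sup_mu4_le_stab : C.sl2CubeAction.range ⊔ C.mu4 ≤ C.stab := by
  intro n hn
  obtain ⟨A, ζ, hζ, h⟩ := C.mem_range_sup_mu4.mp hn
  intro y
  obtain ⟨a, rfl⟩ := C.cubeEquiv.surjective y
  rw [h, q_cubeEquiv, q_cubeEquiv, hdet_smul, hζ, one_mul, hdet_tensorAction]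

theorem diagramAction_mem_stab (h6 : (6 : K) ≠ 0) (σ : Equiv.Perm (Fin 3)) :
    C.diagramAction σ ∈ C.stab :=
  (C.mem_stab_iff h6 (C.diagramAction_cubeEquiv σ)).mpr (hdet_permAction σ)

theorem exists_eq_mul_diagramAction [IsSepClosed K] (h2 : (2 : K) ≠ 0) (h3 : (3 : K) ≠ 0)
    {g : C.g1 ≃ₗ[K] C.g1} (hg : g ∈ C.stab) :
    ∃ n ∈ C.sl2CubeAction.range ⊔ C.mu4, ∃ σ, g = n * C.diagramAction σ := by
  have h6 : (6 : K) ≠ 0 := by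
    rw [show (6 : K) = 2 * 3 by norm_num]
    exact mul_ne_zero h2 h3
  have hg' : ∀ a, g (C.cubeEquiv a) = C.cubeEquiv (C.cubeConj.symm g a) :=
    C.eq_cubeConj_iff.mp (C.cubeConj.apply_symm_apply g).symm
  obtain ⟨A, ζ, σ, hζ, h⟩ := exists_decomposition h2 h3 ((C.mem_stab_iff h6 hg').mp hg)
  refine ⟨g * (C.diagramAction σ)⁻¹, C.mem_range_sup_mu4.mpr ⟨A, ζ, hζ, fun a => ?_⟩, σ, by simp⟩
  rw [← map_inv, LinearEquiv.mul_apply, diagramAction_cubeEquiv, hg', h,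
    permAction_permAction_inv]

theorem diagramAction_conj_mem (σ : Equiv.Perm (Fin 3)) (n : C.g1 ≃ₗ[K] C.g1)
    (hn : n ∈ C.sl2CubeAction.range ⊔ C.mu4) :
    C.diagramAction σ * n * (C.diagramAction σ)⁻¹ ∈ C.sl2CubeAction.range ⊔ C.mu4 := by
  obtain ⟨A, ζ, hζ, h⟩ := C.mem_range_sup_mu4.mp hn
  refine C.mem_range_sup_mu4.mpr ⟨A ∘ σ.symm, ζ, hζ, fun a => ?_⟩
  rw [← map_inv, LinearEquiv.mul_apply, LinearEquiv.mul_apply, diagramAction_cubeEquiv, h,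
    diagramAction_cubeEquiv, map_smul, permAction_tensorAction,
    permAction_permAction_inv]

theorem eq_one_of_diagramAction_mem (σ : Equiv.Perm (Fin 3))
    (hσ : C.diagramAction σ ∈ C.sl2CubeAction.range ⊔ C.mu4) : σ = 1 := by
  obtain ⟨A, ζ, -, h⟩ := C.mem_range_sup_mu4.mp hσ
  refine eq_one_of_permAction_eq (A := A) (ζ := ζ) fun y => C.cubeEquiv.injective ?_
  rw [← h, diagramAction_cubeEquiv]

end ChevalleyBasis

/-! ### The stabilizer under extension of scalars -/

theorem map_hdet {R S : Type*} [CommRing R] [CommRing S] (f : R →+* S) (y : Cube R) :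
    f (hdet y) = hdet fun s => f (y s) := by
  simp [hdet_eq, map_ofNat f 4]

theorem isHomogeneous_hdet {R ι : Type*} [CommRing R] {y : Cube (MvPolynomial ι R)}
    (h : ∀ s, (y s).IsHomogeneous 1) : (hdet y).IsHomogeneous 4 := by
  have h2 : ∀ s t, (y s * y t).IsHomogeneous 2 := fun s t => (h s).mul (h t)
  have h4 : (4 : MvPolynomial ι R).IsHomogeneous 0 := MvPolynomial.isHomogeneous_C ι (4 : R)
  rw [hdet_eq]
  exact ((((h2 _ _).add (h2 _ _)).sub (h2 _ _)).sub (h2 _ _)).pow 2 |>.sub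
    ((h4.mul ((h2 _ _).sub (h2 _ _))).mul ((h2 _ _).sub (h2 _ _)))

section

variable {F K : Type*} [Field F] [Field K] [Algebra F K]

/-- A field in which `6` is invertible has enough elements for a quartic form to be determined by
its values, so that a matrix that preserves the hyperdeterminant still does so after an extension
of scalars. -/
theorem hdet_extendScalars (h2 : (2 : F) ≠ 0) (h3 : (3 : F) ≠ 0)
    {M : Matrix (Fin 3 → Fin 2) (Fin 3 → Fin 2) F} (hM : ∀ a, hdet (M *ᵥ a) = hdet a)
    (y : Cube K) : hdet (M.map (algebraMap F K) *ᵥ y) = hdet y := by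
  classical
  let P : MvPolynomial (Fin 3 → Fin 2) F :=
    hdet (fun s => ∑ t, MvPolynomial.C (M s t) * MvPolynomial.X t) - hdet MvPolynomial.X
  have hdeg : P.IsHomogeneous 4 := by
    refine (isHomogeneous_hdet fun s => ?_).sub
      (isHomogeneous_hdet fun s => MvPolynomial.isHomogeneous_X F s)
    exact MvPolynomial.IsHomogeneous.sum _ _ _ fun t _ =>
      (MvPolynomial.isHomogeneous_C _ _).mul (MvPolynomial.isHomogeneous_X F t)
  have hP : P = 0 := by
    have h4 : (4 : F) ≠ 0 := by
      rw [show (4 : F) = 2 * 2 by norm_num]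
      exact mul_ne_zero h2 h2
    let T : Finset F := {0, 1, -1, 2, -2}
    have hT : T.card = 5 := by
      rw [Finset.card_insert_of_notMem, Finset.card_insert_of_notMem,
        Finset.card_insert_of_notMem, Finset.card_pair]
      · exact fun h => h4 (by linear_combination h)
      · simp only [Finset.mem_insert, Finset.mem_singleton, not_or]
        exact ⟨fun h => h3 (by linear_combination -h),
          fun h => one_ne_zero (by linear_combination h)⟩
      · simp only [Finset.mem_insert, Finset.mem_singleton, not_or]
        exact ⟨fun h => h2 (by linear_combination h),
          fun h => one_ne_zero (by linear_combination -h),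
          fun h => h3 (by linear_combination h)⟩
      · simp only [Finset.mem_insert, Finset.mem_singleton, not_or]
        exact ⟨fun h => one_ne_zero (by linear_combination -h),
          fun h => one_ne_zero (by linear_combination h), fun h => h2 (by linear_combination -h),
          fun h => h2 (by linear_combination h)⟩
    refine MvPolynomial.eq_zero_of_eval_zero_at_prod_finset P (fun _ => T) (fun i => ?_)
      fun a _ => ?_
    · rw [hT]
      have := P.degreeOf_le_totalDegree i
      have := hdeg.totalDegree_le
      omega
    · change MvPolynomial.eval a _ = 0
      rw [map_sub, map_hdet, map_hdet, sub_eq_zero]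
      convert hM a using 2 <;> ext s <;> simp [Matrix.mulVec, dotProduct]
  have := congrArg (MvPolynomial.aeval y : _ →ₐ[F] K).toRingHom hP
  simp only [P, map_sub, map_zero, map_hdet, sub_eq_zero] at this
  convert this using 2 <;> ext s <;> simp [Matrix.mulVec, dotProduct]

/-- An automorphism of the space of cubes over `F` extends to cubes over `K`. -/
theorem exists_extendScalars (h2 : (2 : F) ≠ 0) (h3 : (3 : F) ≠ 0) {g : Cube F ≃ₗ[F] Cube F}
    (hg : ∀ a, hdet (g a) = hdet a) : ∃ g' : Cube K ≃ₗ[K] Cube K,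
      (∀ y, hdet (g' y) = hdet y) ∧ ∀ a : Cube F,
        g' (fun s => algebraMap F K (a s)) = fun s => algebraMap F K (g a s) := by
  have hM : ∀ h : Cube F ≃ₗ[F] Cube F, ∀ a, LinearMap.toMatrix' (h : Cube F →ₗ[F] Cube F) *ᵥ a =
      h a := fun h a => by
    rw [LinearMap.toMatrix'_mulVec]
    rfl
  have hmul : ∀ h h' : Cube F ≃ₗ[F] Cube F, (∀ a, h (h' a) = a) →
      (LinearMap.toMatrix' (h : Cube F →ₗ[F] Cube F)).map (algebraMap F K) *
        (LinearMap.toMatrix' (h' : Cube F →ₗ[F] Cube F)).map (algebraMap F K) = 1 := by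
    intro h h' hh
    rw [← Matrix.map_mul, ← LinearMap.toMatrix'_comp, ← Matrix.map_one (algebraMap F K)
      (map_zero _) (map_one _), ← LinearMap.toMatrix'_id]
    congr 2
    exact LinearMap.ext hh
  refine ⟨Matrix.toLin'OfInv (hmul g.symm g g.symm_apply_apply)
    (hmul g g.symm g.apply_symm_apply), fun y => ?_, fun a => ?_⟩
  · exact hdet_extendScalars h2 h3 (fun a => by rw [hM, hg]) y
  · ext s
    have := congrArg (algebraMap F K) (congrFun (hM g a) s)
    rw [← this]
    exact (RingHom.map_mulVec (algebraMap F K) _ a s).symm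

end

namespace ChevalleyBasis

variable {F L : Type*} [Field F] [LieRing L] [LieAlgebra F L] (C : ChevalleyBasis F L)
  (K : Type*) [Field K] [Algebra F K]

theorem baseChange_x (β : Root) : (C.baseChange K).x β = (1 : K) ⊗ₜ[F] C.x β := by
  simp [x, baseChange]

theorem baseChange_vec (s : Fin 3 → Fin 2) : (C.baseChange K).vec s = (1 : K) ⊗ₜ[F] C.vec s := by
  have h : ∀ i a y, (C.baseChange K).raise i a ((1 : K) ⊗ₜ[F] y) = 1 ⊗ₜ[F] C.raise i a y := by
    intro i a y
    unfold raise
    split_ifs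
    · rw [e, baseChange_x, LieAlgebra.ExtendScalars.bracket_tmul, one_mul, e]
    · rfl
  rw [vec, baseChange_x, h, h, h, vec]

theorem toBaseChange_cubeEquiv (a : Cube F) : C.toBaseChange K (C.cubeEquiv a) =
    (C.baseChange K).cubeEquiv fun s => algebraMap F K (a s) := by
  refine Subtype.ext ?_
  change (1 : K) ⊗ₜ[F] C.ofCube a = (C.baseChange K).ofCube _
  rw [ofCube_apply, ofCube_apply, TensorProduct.tmul_sum]
  refine Finset.sum_congr rfl fun s _ => ?_
  rw [baseChange_vec, TensorProduct.tmul_smul, algebraMap_smul]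

theorem q_toBaseChange (y : C.g1) :
    (C.baseChange K).q (C.toBaseChange K y) = algebraMap F K (C.q y) := by
  obtain ⟨a, rfl⟩ := C.cubeEquiv.surjective y
  rw [toBaseChange_cubeEquiv, q_cubeEquiv, q_cubeEquiv, map_mul, map_hdet, map_ofNat]

theorem mem_stab_iff_baseChange (h2 : (2 : F) ≠ 0) (h3 : (3 : F) ≠ 0) (g : C.g1 ≃ₗ[F] C.g1) :
    g ∈ C.stab ↔
      ∃ g' ∈ (C.baseChange K).stab, ∀ y, C.toBaseChange K (g y) = g' (C.toBaseChange K y) := by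
  constructor
  · intro hg
    have h6 : (6 : F) ≠ 0 := by
      rw [show (6 : F) = 2 * 3 by norm_num]
      exact mul_ne_zero h2 h3
    have hg' : ∀ a, g (C.cubeEquiv a) = C.cubeEquiv (C.cubeConj.symm g a) :=
      C.eq_cubeConj_iff.mp (C.cubeConj.apply_symm_apply g).symm
    obtain ⟨k, hk, hkg⟩ := exists_extendScalars (K := K) h2 h3 ((C.mem_stab_iff h6 hg').mp hg)
    refine ⟨(C.baseChange K).cubeConj k, fun y => ?_, fun y => ?_⟩
    · obtain ⟨a, rfl⟩ := (C.baseChange K).cubeEquiv.surjective y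
      rw [cubeConj_cubeEquiv, q_cubeEquiv, q_cubeEquiv, hk]
    · obtain ⟨a, rfl⟩ := C.cubeEquiv.surjective y
      rw [hg', toBaseChange_cubeEquiv, toBaseChange_cubeEquiv, cubeConj_cubeEquiv, hkg]
  · rintro ⟨g', hg', h⟩ y
    refine (algebraMap F K).injective ?_
    rw [← q_toBaseChange, ← q_toBaseChange, h]
    exact hg' _

end ChevalleyBasis
end D4

theorem mainTheorem4 (F : Type*) [Field F] (h2 : (2 : F) ≠ 0) (h3 : (3 : F) ≠ 0)
    (L : Type*) [LieRing L] [LieAlgebra F L] (C : D4.ChevalleyBasis F L) :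
    Module.finrank F C.g1 = 8 ∧
    (∃ e : C.g1 ≃ₗ[F] (Fin 2 → Fin 2 → Fin 2 → F), ∀ y, C.q y = 6 * D4.cubeDisc (e y)) ∧
    ∀ (K : Type*) [Field K] [Algebra F K] [IsSepClosed K],
      ∃ (φ : (Fin 3 → Matrix.SpecialLinearGroup (Fin 2) K) →*
            ((C.baseChange K).g1 ≃ₗ[K] (C.baseChange K).g1))
        (δ : Equiv.Perm (Fin 3) →* ((C.baseChange K).g1 ≃ₗ[K] (C.baseChange K).g1)),
        (C.baseChange K).IsSL2CubeAction φ ∧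
        (C.baseChange K).IsDiagramAction δ ∧
        (∃ (θ : Equiv.Perm (Fin 3) →* MulAut ↥(φ.range ⊔ (C.baseChange K).mu4))
            (e : ↥(φ.range ⊔ (C.baseChange K).mu4) ⋊[θ] Equiv.Perm (Fin 3) ≃*
              ↥(C.baseChange K).stab),
            ∀ n σ, (e ⟨n, σ⟩ : (C.baseChange K).g1 ≃ₗ[K] (C.baseChange K).g1) = ↑n * δ σ) ∧
        ∀ g : C.g1 ≃ₗ[F] C.g1, g ∈ C.stab ↔
          ∃ n ∈ φ.range ⊔ (C.baseChange K).mu4, ∃ σ : Equiv.Perm (Fin 3),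
            ∀ y : C.g1, C.toBaseChange K (g y) = (n * δ σ) (C.toBaseChange K y) := by
  refine ⟨C.finrank_g1, ⟨C.cubeCoordinates, C.q_eq_cubeDisc⟩, fun K _ _ _ => ?_⟩
  have hK : ∀ {n : ℕ}, (n : F) ≠ 0 → (n : K) ≠ 0 := fun {n} h => by
    rw [← map_natCast (algebraMap F K)]
    exact (map_ne_zero _).mpr h
  have h2K : (2 : K) ≠ 0 := by exact_mod_cast hK (n := 2) (by exact_mod_cast h2)
  have h3K : (3 : K) ≠ 0 := by exact_mod_cast hK (n := 3) (by exact_mod_cast h3)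
  have h6K : (6 : K) ≠ 0 := by
    rw [show (6 : K) = 2 * 3 by norm_num]
    exact mul_ne_zero h2K h3K
  let D := C.baseChange K
  have hN := D.range_sup_mu4_le_stab
  have hδ := D.diagramAction_mem_stab h6K
  refine ⟨D.sl2CubeAction, D.diagramAction, D.isSL2CubeAction_sl2CubeAction,
    D.isDiagramAction_diagramAction,
    D4.exists_semidirectProduct_mulEquiv hN hδ D.diagramAction_conj_mem
      D.eq_one_of_diagramAction_mem
      fun _ hg => D.exists_eq_mul_diagramAction h2K h3K hg,
    fun g => (C.mem_stab_iff_baseChange K h2 h3 g).trans ⟨?_, ?_⟩⟩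
  · rintro ⟨g', hg', h⟩
    obtain ⟨n, hn, σ, rfl⟩ := D.exists_eq_mul_diagramAction h2K h3K hg'
    exact ⟨n, hn, σ, h⟩
  · rintro ⟨n, hn, σ, h⟩
    exact ⟨n * D.diagramAction σ, mul_mem (hN hn) (hδ σ), h⟩
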